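/- For $n\ge 1$ and a tensor $t=\sum_{i,j,k=1}^n t_{ijk}\,e_i\otimes e_j\otimes e_k$ in $\ell_1^n\otimes\ell_1^n\otimes\ell_1^n$ (complex coefficients $t_{ijk}$), put $$\|t\|_{\min}=\sup\Big\{\Big\|\sum_{i,j,k} t_{ijk}\,u_i\otimes v_j\otimes w_k\Big\|_{B(H\otimes_2H\otimes_2H)}\Big\},$$ where the supremum runs over all complex Hilbert spaces $H$ and all unitary operators $u_i,v_j,w_k$ ($1\le i,j,k\le n$) on $H$, and $\otimes_2$ is the (completed) Hilbert space tensor product; and put $$\|t\|_{\vee}=\sup\Big\{\Big|\sum_{i,j,k} t_{ijk}\,x_iy_jz_k\Big|\Big\},$$ where the supremum runs over all complex scalars $x_i,y_j,z_k$ of modulus $1$; equivalently, $\|t\|_\vee$ is the first supremum restricted to $\dim H=1$. Let $$C_3(n)=\sup\{\|t\|_{\min} : t\in \ell_1^n\otimes\ell_1^n\otimes\ell_1^n,\ \|t\|_{\vee}\le 1\}.$$ Then the equivalence just stated holds, and there is a constant $C'>0$, independent of $n$, such that for all $n\ge 2$ $$C_3(n)\ge C'\,n^{1/4}(\log n)^{-3/2}.$$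 -/

import Mathlib

open scoped TensorProduct ENNReal

universe u

noncomputable section

/-- The coefficient array `(t_{ijk})` of the tensor
`t = ∑ t_{ijk} e_i ⊗ e_j ⊗ e_k` in `ℓ₁ⁿ ⊗ ℓ₁ⁿ ⊗ ℓ₁ⁿ` (complex scalars). -/
abbrev Tensor3 (n : ℕ) : Type := Fin n → Fin n → Fin n → ℂ

section HilbertTensor

variable (E F : Type u) [NormedAddCommGroup E] [InnerProductSpace ℂ E]
  [NormedAddCommGroup F] [InnerProductSpace ℂ F]

/-- The Hilbert space tensor product `E ⊗₂ F`: the completion of the algebraic tensor product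
for the inner product `⟪a ⊗ b, a' ⊗ b'⟫ = ⟪a, a'⟫ ⟪b, b'⟫`. -/
def HilbertTensor : Type u := UniformSpace.Completion (E ⊗[ℂ] F)

namespace HilbertTensor

instance instNormedAddCommGroup : NormedAddCommGroup (HilbertTensor E F) :=
  inferInstanceAs (NormedAddCommGroup (UniformSpace.Completion (E ⊗[ℂ] F)))

instance instInnerProductSpace : InnerProductSpace ℂ (HilbertTensor E F) :=
  inferInstanceAs (InnerProductSpace ℂ (UniformSpace.Completion (E ⊗[ℂ] F)))

instance instCompleteSpace : CompleteSpace (HilbertTensor E F) :=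
  inferInstanceAs (CompleteSpace (UniformSpace.Completion (E ⊗[ℂ] F)))

/-- The canonical isometric embedding of the algebraic tensor product. -/
def incl : (E ⊗[ℂ] F) →ₗᵢ[ℂ] HilbertTensor E F :=
  UniformSpace.Completion.toComplₗᵢ (𝕜 := ℂ) (E := E ⊗[ℂ] F)

variable {E F}

/-- The pure tensor `a ⊗ b` in `E ⊗₂ F`. -/
def tmul (a : E) (b : F) : HilbertTensor E F := incl E F (a ⊗ₜ[ℂ] b)

theorem inner_tmul (a a' : E) (b b' : F) :
    inner ℂ (tmul a b) (tmul a' b') = inner ℂ a a' * inner ℂ b b' :=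
  ((incl E F).inner_map_map _ _).trans (TensorProduct.inner_tmul _ _ _ _ _)

theorem denseRange_incl : DenseRange (incl E F) :=
  UniformSpace.Completion.denseRange_coe

/-- The operator `u ⊗ v` on `E ⊗₂ F`, for linear isometries `u` and `v`: the continuous extension
of the algebraic tensor product of `u` and `v`. -/
def map (u : E →ₗᵢ[ℂ] E) (v : F →ₗᵢ[ℂ] F) : HilbertTensor E F →ₗᵢ[ℂ] HilbertTensor E F where
  toLinearMap :=
    ((TensorProduct.mapIsometry u v).toContinuousLinearMap.completion).toLinearMap
  norm_map' := (AddMonoidHomClass.isometry_iff_norm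
    ((TensorProduct.mapIsometry u v).toContinuousLinearMap.completion)).1
      (TensorProduct.mapIsometry u v).isometry.completion_map

theorem map_incl (u : E →ₗᵢ[ℂ] E) (v : F →ₗᵢ[ℂ] F) (x : E ⊗[ℂ] F) :
    map u v (incl E F x) = incl E F (TensorProduct.mapIsometry u v x) :=
  ContinuousLinearMap.completion_apply_coe (TensorProduct.mapIsometry u v).toContinuousLinearMap x

theorem map_tmul (u : E →ₗᵢ[ℂ] E) (v : F →ₗᵢ[ℂ] F) (a : E) (b : F) :
    map u v (tmul a b) = tmul (u a) (v b) :=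
  map_incl u v _

end HilbertTensor

end HilbertTensor

/-- The Hilbert space `H ⊗₂ H ⊗₂ H`. -/
abbrev HilbertTensor3 (H : Type u) [NormedAddCommGroup H] [InnerProductSpace ℂ H] : Type u :=
  HilbertTensor H (HilbertTensor H H)

/-- The operator `u ⊗ v ⊗ w` on `H ⊗₂ H ⊗₂ H`, for unitary operators `u, v, w` on `H`
(a unitary operator is a surjective linear isometry). -/
def tensorUnitary {H : Type u} [NormedAddCommGroup H] [InnerProductSpace ℂ H]
    (u v w : H ≃ₗᵢ[ℂ] H) : HilbertTensor3 H →L[ℂ] HilbertTensor3 H :=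
  (HilbertTensor.map u.toLinearIsometry
    (HilbertTensor.map v.toLinearIsometry w.toLinearIsometry)).toContinuousLinearMap

/-- The supremum of `‖∑ t_{ijk} u_i ⊗ v_j ⊗ w_k‖` in `B(H ⊗₂ H ⊗₂ H)` over all unitary operators
`u_i, v_j, w_k` on the given Hilbert space `H`. -/
def unitarySup (H : Type u) [NormedAddCommGroup H] [InnerProductSpace ℂ H] {n : ℕ}
    (t : Tensor3 n) : ℝ≥0∞ :=
  ⨆ (u : Fin n → (H ≃ₗᵢ[ℂ] H)) (v : Fin n → (H ≃ₗᵢ[ℂ] H)) (w : Fin n → (H ≃ₗᵢ[ℂ] H)),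
    ‖∑ i, ∑ j, ∑ k, t i j k • tensorUnitary (u i) (v j) (w k)‖ₑ

/-- `‖t‖_min`: the supremum over all complex Hilbert spaces `H` (of an arbitrary universe `u`). -/
def minNorm {n : ℕ} (t : Tensor3 n) : ℝ≥0∞ :=
  ⨆ (H : Type u) (_ : NormedAddCommGroup H) (_ : InnerProductSpace ℂ H) (_ : CompleteSpace H),
    unitarySup H t

/-- `‖t‖_∨`: the supremum of `|∑ t_{ijk} x_i y_j z_k|` over all unimodular complex scalars. -/
def veeNorm {n : ℕ} (t : Tensor3 n) : ℝ≥0∞ :=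
  ⨆ (x : Fin n → Circle) (y : Fin n → Circle) (z : Fin n → Circle),
    ‖∑ i, ∑ j, ∑ k, t i j k * (x i : ℂ) * (y j : ℂ) * (z k : ℂ)‖ₑ

/-- `C₃(n) = sup {‖t‖_min : ‖t‖_∨ ≤ 1}`. -/
def C3 (n : ℕ) : ℝ≥0∞ :=
  ⨆ (t : Tensor3 n) (_ : veeNorm t ≤ 1), minNorm.{u} t

end

/-! Put `N = ⌊√n⌋` and let `G` be cyclic of order `N`. The `N²` Pauli matrices `P_a` of `G` are
unitary and orthogonal. For sign tensors `g`, `h` on `G³` let `t_{abc} = ⟨g, (P_a ⊗ P_b ⊗ P_c) h⟩`,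
extended by zero to indices below `n`.

Lower bound: insert the conjugates of the `P_a` as unitaries and pair the resulting operator with
`g` and `h`. This gives `∑ |t_{abc}|²`, which Parseval evaluates to `N⁹` whatever the signs are.
Since `‖g‖ ‖h‖ = N³`, the operator norm is at least `N⁶`
(`card_pow_six_le_norm_sum_smul_tensorUnitary`).

Upper bound: unimodular scalars produce `X = ∑ x_a P_a` with Frobenius norm `N^{3/2}`. It therefore
suffices to find signs with `|⟨g, (X ⊗ Y ⊗ Z) h⟩| ≲ N (log n)^{3/2}` times the three Frobenius
norms. Then `‖t‖_∨ ≲ N^{11/2} (log n)^{3/2}`, and the quotient is of order `√N (log n)^{-3/2}`.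

The signs come from a union bound over nets, in two stages: `h` is chosen so that all its
contractions by thin matrices are short, then `g` against these contractions. For contractions of
ranks `r, s, t`, none exceeding the product of the other two, this gives `N √(rst)`
(`exists_boundedOnTriangularRanks`). Other ranks reduce to these, because the form sees only a
compression of its argument of largest rank (`exists_rank_le_trilinForm_eq`). Splitting each matrix
into logarithmically many nearly flat pieces replaces rank and operator norm by the Frobenius norm
and costs `√log` per argument (`BoundedOnTriangularRanks.abs_trilinForm_le_frobNorm`). -/

section RandomForms

/-! ### Nets of unit balls and tail bounds for random signs. -/

open scoped Matrix.Norms.L2Operator Kronecker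

/-- Halving a maximal `1`-separated subset of the ball of radius `2` gives a `1/2`-net of the unit
ball, so the norm of `f` is at most `c` plus half of itself. The norm on `E` is arbitrary: the lemma
serves both operator norms and Euclidean norms. -/
theorem exists_finset_net (E : Type*) [NormedAddCommGroup E] [NormedSpace ℝ E]
    [FiniteDimensional ℝ E] :
    ∃ S : Finset E, S.card ≤ 5 ^ Module.finrank ℝ E ∧ (∀ x ∈ S, ‖x‖ ≤ 1) ∧
      ∀ f : E → ℝ, IsLinearMap ℝ f → ∀ c : ℝ, (∀ x ∈ S, |f x| ≤ c) →
        ∀ x, ‖x‖ ≤ 1 → |f x| ≤ 2 * c := by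
  classical
  let P : ℕ → Prop := fun k => ∃ S : Finset E, S.card = k ∧ (∀ x ∈ S, ‖x‖ ≤ 2) ∧
    ∀ x ∈ S, ∀ y ∈ S, x ≠ y → 1 ≤ ‖x - y‖
  have hP : ∀ k, P k → k ≤ 5 ^ Module.finrank ℝ E := by
    rintro k ⟨S, rfl, h1, h2⟩
    exact Besicovitch.card_le_of_separated S h1 h2
  have h0 : P 0 := ⟨∅, by simp⟩
  obtain ⟨S, hS, h1, h2⟩ : P (Nat.findGreatest P (5 ^ Module.finrank ℝ E)) :=
    Nat.findGreatest_spec (Nat.zero_le _) h0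
  have hmax : ∀ x, ‖x‖ ≤ 2 → ∃ s ∈ S, ‖x - s‖ ≤ 1 := by
    intro x hx
    by_contra! hc
    have hxS : x ∉ S := fun h => by
      have := hc x h
      simp at this
      linarith
    have hP1 : P (S.card + 1) := by
      refine ⟨insert x S, Finset.card_insert_of_notMem hxS, ?_, ?_⟩
      · intro y hy
        rcases Finset.mem_insert.1 hy with rfl | hy
        exacts [hx, h1 y hy]
      · intro y hy z hz hyz
        rcases Finset.mem_insert.1 hy with hy' | hy' <;>
          rcases Finset.mem_insert.1 hz with hz' | hz'
        · exact absurd (hy'.trans hz'.symm) hyz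
        · rw [hy']; exact (hc z hz').le
        · rw [hz', norm_sub_rev]; exact (hc y hy').le
        · exact h2 y hy' z hz' hyz
    have := Nat.le_findGreatest (hP _ hP1) hP1
    omega
  refine ⟨S.image (fun x => (1 / 2 : ℝ) • x), ?_, ?_, ?_⟩
  · refine Finset.card_image_le.trans ?_
    rw [hS]; exact Nat.findGreatest_le _
  · intro x hx
    obtain ⟨y, hy, rfl⟩ := Finset.mem_image.1 hx
    rw [norm_smul]; norm_num; linarith [h1 y hy]
  · intro f hf c hc x hx
    let F : E →L[ℝ] ℝ := LinearMap.toContinuousLinearMap (hf.mk' f)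
    have hF : ∀ y, F y = f y := fun y => rfl
    have hb : ∀ y, ‖y‖ ≤ 1 → |f y| ≤ c + ‖F‖ / 2 := by
      intro y hy
      obtain ⟨s, hs, hys⟩ := hmax ((2 : ℝ) • y) (by rw [norm_smul]; norm_num; linarith)
      have e : f y = f ((1 / 2 : ℝ) • s) + F ((1 / 2 : ℝ) • ((2 : ℝ) • y - s)) := by
        rw [hF, ← hf.map_add]
        congr 1
        rw [smul_sub, smul_smul]; norm_num
      have e1 := hc _ (Finset.mem_image_of_mem _ hs)
      have e2 : |F ((1 / 2 : ℝ) • ((2 : ℝ) • y - s))| ≤ ‖F‖ * (1 / 2) := by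
        refine (F.le_opNorm _).trans ?_
        gcongr
        rw [norm_smul]; norm_num; linarith
      rw [e]
      exact (abs_add_le _ _).trans (by linarith)
    have hc0 : 0 ≤ c + ‖F‖ / 2 := (abs_nonneg _).trans (hb 0 (by simp))
    have hn : ‖F‖ ≤ c + ‖F‖ / 2 :=
      ContinuousLinearMap.opNorm_le_of_unit_norm hc0 fun y hy => hb y hy.le
    linarith [hb x hx]

/-- Sub-Gaussian tails with a union bound, done by counting. From `cosh x ≤ exp (x² / 2)`, the mean
of `exp (∑ ε_k b_k)` over signs is at most `exp (∑ b_k² / 2)`. If every choice of signs violated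
some inequality, summing these exponential moments with parameter `τ j / σ j` would contradict `hs`.
-/
theorem exists_signs {K J : Type*} [Fintype K] [Fintype J] (a : J → K → ℝ) (σ τ : J → ℝ)
    (hσ : ∀ j, 0 < σ j) (hτ : ∀ j, 0 ≤ τ j) (ha : ∀ j, ∑ k, a j k ^ 2 ≤ σ j ^ 2)
    (hs : ∑ j, 2 * Real.exp (-(τ j ^ 2 / 2)) < 1) :
    ∃ ε : K → ℝ, (∀ k, ε k = 1 ∨ ε k = -1) ∧ ∀ j, |∑ k, ε k * a j k| ≤ σ j * τ j := by
  classical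
  let sg : Bool → ℝ := fun b => if b then 1 else -1
  have hsg : ∀ b, sg b = 1 ∨ sg b = -1 := by intro b; cases b <;> simp [sg]
  by_contra! hcon
  have hcon' : ∀ ω : K → Bool, ∃ j, σ j * τ j < |∑ k, sg (ω k) * a j k| := fun ω =>
    hcon (fun k => sg (ω k)) fun k => hsg _
  have mgf : ∀ b : K → ℝ, ∑ ω : K → Bool, Real.exp (∑ k, sg (ω k) * b k) ≤
      2 ^ Fintype.card K * Real.exp ((∑ k, b k ^ 2) / 2) := by
    intro b
    calc ∑ ω : K → Bool, Real.exp (∑ k, sg (ω k) * b k)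
        = ∑ ω : K → Bool, ∏ k, Real.exp (sg (ω k) * b k) := by simp_rw [Real.exp_sum]
      _ = ∏ k, ∑ x : Bool, Real.exp (sg x * b k) :=
          (Fintype.prod_sum (fun k (x : Bool) => Real.exp (sg x * b k))).symm
      _ = ∏ k, 2 * Real.cosh (b k) := by
          refine Finset.prod_congr rfl fun k _ => ?_
          simp [sg, Real.cosh_eq]; ring
      _ ≤ ∏ k, 2 * Real.exp (b k ^ 2 / 2) := by
          refine Finset.prod_le_prod (fun k _ => by positivity) fun k _ => ?_
          gcongr
          exact Real.cosh_le_exp_half_sq _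
      _ = _ := by
          rw [Finset.prod_mul_distrib, ← Real.exp_sum, Finset.sum_div]; simp
  let b : J → K → ℝ := fun j k => τ j / σ j * a j k
  have hb : ∀ j, ∑ k, b j k ^ 2 ≤ τ j ^ 2 := by
    intro j
    have : ∑ k, b j k ^ 2 = (τ j / σ j) ^ 2 * ∑ k, a j k ^ 2 := by
      rw [Finset.mul_sum]; exact Finset.sum_congr rfl fun k _ => by simp only [b]; ring
    rw [this]
    calc _ ≤ (τ j / σ j) ^ 2 * σ j ^ 2 := by gcongr; exact ha j
      _ = _ := by have := (hσ j).ne'; field_simp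
  let Φ : J → (K → Bool) → ℝ := fun j ω =>
    Real.exp (∑ k, sg (ω k) * b j k) + Real.exp (∑ k, sg (ω k) * (-b j k))
  have h1 : ∀ ω : K → Bool, 1 ≤ ∑ j, Real.exp (-τ j ^ 2) * Φ j ω := by
    intro ω
    obtain ⟨j, hj⟩ := hcon' ω
    refine le_trans ?_ (Finset.single_le_sum
      (f := fun j => Real.exp (-τ j ^ 2) * Φ j ω) (fun j _ => by positivity) (Finset.mem_univ j))
    have e : ∑ k, sg (ω k) * b j k = τ j / σ j * ∑ k, sg (ω k) * a j k := by
      rw [Finset.mul_sum]; exact Finset.sum_congr rfl fun k _ => by simp only [b]; ring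
    have e' : ∑ k, sg (ω k) * (-b j k) = -∑ k, sg (ω k) * b j k := by
      rw [← Finset.sum_neg_distrib]; exact Finset.sum_congr rfl fun k _ => by ring
    have hle : τ j ^ 2 ≤ |∑ k, sg (ω k) * b j k| := by
      rw [e, abs_mul, abs_of_nonneg (div_nonneg (hτ j) (hσ j).le)]
      calc τ j ^ 2 = τ j / σ j * (σ j * τ j) := by have := (hσ j).ne'; field_simp
        _ ≤ _ := by
          have := div_nonneg (hτ j) (hσ j).le
          gcongr
    have hΦ : Real.exp (τ j ^ 2) ≤ Φ j ω := by
      simp only [Φ, e']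
      rcases le_abs.1 hle with h | h
      · have := Real.exp_le_exp.2 h
        linarith [Real.exp_pos (-∑ k, sg (ω k) * b j k)]
      · have := Real.exp_le_exp.2 h
        linarith [Real.exp_pos (∑ k, sg (ω k) * b j k)]
    calc (1 : ℝ) = Real.exp (-τ j ^ 2) * Real.exp (τ j ^ 2) := by
          rw [← Real.exp_add]; simp
      _ ≤ _ := by gcongr
  have h2 : ∀ j, ∑ ω, Φ j ω ≤ 2 ^ Fintype.card K * (2 * Real.exp (τ j ^ 2 / 2)) := by
    intro j
    simp only [Φ, Finset.sum_add_distrib]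
    have q1 := mgf (b j)
    have q2 := mgf (fun k => -b j k)
    simp only [neg_sq] at q2
    have q3 : Real.exp ((∑ k, b j k ^ 2) / 2) ≤ Real.exp (τ j ^ 2 / 2) :=
      Real.exp_le_exp.2 (by linarith [hb j])
    have q4 : (2 : ℝ) ^ Fintype.card K * Real.exp ((∑ k, b j k ^ 2) / 2) ≤
      2 ^ Fintype.card K * Real.exp (τ j ^ 2 / 2) := by gcongr
    linarith
  have h3 : (2 : ℝ) ^ Fintype.card K ≤
      ∑ j, Real.exp (-τ j ^ 2) * (2 ^ Fintype.card K * (2 * Real.exp (τ j ^ 2 / 2))) := by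
    calc (2 : ℝ) ^ Fintype.card K = ∑ ω : K → Bool, 1 := by simp
      _ ≤ ∑ ω : K → Bool, ∑ j, Real.exp (-τ j ^ 2) * Φ j ω :=
          Finset.sum_le_sum fun ω _ => h1 ω
      _ = ∑ j, Real.exp (-τ j ^ 2) * ∑ ω, Φ j ω := by
          rw [Finset.sum_comm]; simp_rw [Finset.mul_sum]
      _ ≤ _ := by gcongr with j; exact h2 j
  have h4 : ∑ j, Real.exp (-τ j ^ 2) * (2 ^ Fintype.card K * (2 * Real.exp (τ j ^ 2 / 2))) =
      2 ^ Fintype.card K * ∑ j, 2 * Real.exp (-(τ j ^ 2 / 2)) := by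
    rw [Finset.mul_sum]
    refine Finset.sum_congr rfl fun j _ => ?_
    have : Real.exp (-(τ j ^ 2 / 2)) = Real.exp (-τ j ^ 2) * Real.exp (τ j ^ 2 / 2) := by
      rw [← Real.exp_add]; congr 1; ring
    rw [this]; ring
  rw [h4] at h3
  have : (0 : ℝ) < 2 ^ Fintype.card K := by positivity
  nlinarith

/-- A union bound over `N³` families, the `i`-th of which has at most `5 ^ D i` members. -/
theorem exists_signs_of_card_le {K ι : Type*} [Fintype K] [Fintype ι] {J : ι → Type*}
    [∀ i, Fintype (J i)] (N : ℕ) (hι : Fintype.card ι ≤ N ^ 3) (D : ι → ℕ)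
    (hD : ∀ i, N + 1 ≤ D i) (hJ : ∀ i, Fintype.card (J i) ≤ 5 ^ D i)
    (a : ∀ i, J i → K → ℝ) (σ : ι → ℝ) (hσ : ∀ i, 0 < σ i)
    (ha : ∀ i j, ∑ k, a i j k ^ 2 ≤ σ i ^ 2) :
    ∃ ε : K → ℝ, (∀ k, ε k = 1 ∨ ε k = -1) ∧
      ∀ i j, |∑ k, ε k * a i j k| ≤ σ i * Real.sqrt (8 * D i) := by
  have hs : ∑ p : Σ i, J i, 2 * Real.exp (-(Real.sqrt (8 * D p.1) ^ 2 / 2)) < 1 := by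
    refine (Fintype.sum_sigma _).trans_lt ?_
    have e4 : Real.exp (-4) ≤ 1 / 40 := by
      have : (40 : ℝ) ≤ Real.exp 4 := by
        have h : Real.exp 4 = Real.exp 1 ^ 4 := by rw [← Real.exp_nat_mul]; norm_num
        rw [h]
        calc (40 : ℝ) ≤ 2.7 ^ 4 := by norm_num
          _ ≤ _ := by gcongr; linarith [Real.exp_one_gt_d9]
      rw [Real.exp_neg, one_div]
      exact inv_anti₀ (by norm_num) this
    -- The tail `2 exp (-4D) ≤ 2 · 40^{-D}` beats the `5^D` members and leaves `2 · 8^{-D}`. As `D ≥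
    -- N + 1`, summing over at most `N³ ≤ 8^N` families gives at most `1/4`.
    have key : ∀ i, ∑ j : J i, 2 * Real.exp (-(Real.sqrt (8 * D i) ^ 2 / 2)) ≤
        2 * (1 / 8) ^ (N + 1) := by
      intro i
      rw [Real.sq_sqrt (by positivity), Finset.sum_const, Finset.card_univ, nsmul_eq_mul]
      have e : Real.exp (-(8 * (D i : ℝ) / 2)) = Real.exp (-4) ^ D i := by
        rw [← Real.exp_nat_mul]; congr 1; ring
      rw [e]
      have c : (Fintype.card (J i) : ℝ) ≤ 5 ^ D i := by exact_mod_cast hJ i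
      calc (Fintype.card (J i) : ℝ) * (2 * Real.exp (-4) ^ D i)
          ≤ 5 ^ D i * (2 * (1 / 40) ^ D i) := by gcongr
        _ = 2 * (1 / 8) ^ D i := by
            rw [mul_left_comm, ← mul_pow]; norm_num
        _ ≤ 2 * (1 / 8) ^ (N + 1) := by
            refine mul_le_mul_of_nonneg_left ?_ (by norm_num)
            exact pow_le_pow_of_le_one (by norm_num) (by norm_num) (hD i)
    refine (Finset.sum_le_sum fun i _ => key i).trans_lt ?_
    rw [Finset.sum_const, Finset.card_univ, nsmul_eq_mul]
    have c1 : (Fintype.card ι : ℝ) ≤ 8 ^ N := by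
      have : Fintype.card ι ≤ 8 ^ N := hι.trans (by
        calc N ^ 3 ≤ (2 ^ N) ^ 3 := Nat.pow_le_pow_left Nat.lt_two_pow_self.le 3
          _ = 8 ^ N := by rw [← pow_mul, mul_comm, pow_mul]; norm_num)
      exact_mod_cast this
    calc (Fintype.card ι : ℝ) * (2 * (1 / 8) ^ (N + 1)) ≤ 8 ^ N * (2 * (1 / 8) ^ (N + 1)) := by
          gcongr
      _ = (8 * (1 / 8)) ^ N * (1 / 4) := by rw [mul_pow, pow_succ]; ring
      _ < 1 := by norm_num
  obtain ⟨ε, h1, h2⟩ := exists_signs (K := K) (J := Σ i, J i) (fun p => a p.1 p.2)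
    (fun p => σ p.1) (fun p => Real.sqrt (8 * D p.1)) (fun p => hσ _)
    (fun p => Real.sqrt_nonneg _) (fun p => ha _ _) hs
  exact ⟨ε, h1, fun i j => h2 ⟨i, j⟩⟩

/-! ### Operator norms of Kronecker products. -/

namespace Matrix

variable {m n p q : Type*} [Fintype m] [Fintype n] [Fintype p] [Fintype q]
  [DecidableEq n] [DecidableEq p]

theorem l2_opNorm_transpose_real [DecidableEq m] (A : Matrix m n ℝ) : ‖Aᵀ‖ = ‖A‖ := by
  rw [← conjTranspose_eq_transpose_of_trivial, l2_opNorm_conjTranspose]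

theorem sum_sq_mulVec_le (A : Matrix m n ℝ) (v : n → ℝ) :
    ∑ i, (A *ᵥ v) i ^ 2 ≤ ‖A‖ ^ 2 * ∑ j, v j ^ 2 := by
  have h := l2_opNorm_mulVec A (WithLp.toLp 2 v)
  have h2 := pow_le_pow_left₀ (norm_nonneg _) h 2
  rw [mul_pow, EuclideanSpace.norm_sq_eq, EuclideanSpace.norm_sq_eq] at h2
  simpa using h2

theorem l2_opNorm_le_of_sum_sq (A : Matrix m n ℝ) {c : ℝ} (hc : 0 ≤ c)
    (h : ∀ v : n → ℝ, ∑ i, (A *ᵥ v) i ^ 2 ≤ c ^ 2 * ∑ j, v j ^ 2) : ‖A‖ ≤ c := by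
  rw [l2_opNorm_def]
  refine ContinuousLinearMap.opNorm_le_bound _ hc fun x => ?_
  refine (sq_le_sq₀ (norm_nonneg _) (by positivity)).1 ?_
  rw [mul_pow, EuclideanSpace.norm_sq_eq, EuclideanSpace.norm_sq_eq]
  simpa using h x.ofLp

theorem l2_opNorm_kronecker_one_le (A : Matrix m n ℝ) :
    ‖A ⊗ₖ (1 : Matrix p p ℝ)‖ ≤ ‖A‖ := by
  refine l2_opNorm_le_of_sum_sq _ (norm_nonneg _) fun v => ?_
  have e : ∀ i k, ((A ⊗ₖ (1 : Matrix p p ℝ)) *ᵥ v) (i, k) = (A *ᵥ fun j => v (j, k)) i := by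
    intro i k
    simp [mulVec, dotProduct, Fintype.sum_prod_type, one_apply]
  rw [Fintype.sum_prod_type_right, Fintype.sum_prod_type_right, Finset.mul_sum]
  refine Finset.sum_le_sum fun k _ => ?_
  simp_rw [e]
  exact sum_sq_mulVec_le A _

theorem l2_opNorm_one_kronecker_le (A : Matrix m n ℝ) :
    ‖(1 : Matrix p p ℝ) ⊗ₖ A‖ ≤ ‖A‖ := by
  refine l2_opNorm_le_of_sum_sq _ (norm_nonneg _) fun v => ?_
  have e : ∀ k i, (((1 : Matrix p p ℝ) ⊗ₖ A) *ᵥ v) (k, i) = (A *ᵥ fun j => v (k, j)) i := by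
    intro k i
    simp [mulVec, dotProduct, Fintype.sum_prod_type, one_apply]
  rw [Fintype.sum_prod_type, Fintype.sum_prod_type, Finset.mul_sum]
  refine Finset.sum_le_sum fun k _ => ?_
  simp_rw [e]
  exact sum_sq_mulVec_le A _

theorem l2_opNorm_kronecker_le [DecidableEq q] (A : Matrix m n ℝ) (B : Matrix p q ℝ) :
    ‖A ⊗ₖ B‖ ≤ ‖A‖ * ‖B‖ := by
  have : A ⊗ₖ B = (A ⊗ₖ (1 : Matrix p p ℝ)) * ((1 : Matrix n n ℝ) ⊗ₖ B) := by
    rw [← mul_kronecker_mul, Matrix.mul_one, Matrix.one_mul]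
  rw [this]
  refine (l2_opNorm_mul _ _).trans ?_
  gcongr
  exacts [l2_opNorm_kronecker_one_le A, l2_opNorm_one_kronecker_le B]

theorem l2_opNorm_kronecker_le_one {m' n' : Type*} [Fintype m'] [Fintype n'] [DecidableEq q]
    [DecidableEq m'] [DecidableEq n'] {A : Matrix m n ℝ} {B : Matrix p q ℝ} {C : Matrix m' n' ℝ}
    (hA : ‖A‖ ≤ 1) (hB : ‖B‖ ≤ 1) (hC : ‖C‖ ≤ 1) : ‖A ⊗ₖ (B ⊗ₖ C)‖ ≤ 1 := by
  refine (l2_opNorm_kronecker_le _ _).trans ?_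
  refine mul_le_one₀ hA (norm_nonneg _) ((l2_opNorm_kronecker_le _ _).trans ?_)
  exact mul_le_one₀ hB (norm_nonneg _) hC

end Matrix

open Matrix

/-- Test against `v / ‖v‖`. By this duality a Euclidean norm is treated as one more linear argument,
to be discretized by a net. -/
theorem sum_sq_le_of_forall_abs_sum_le {K : Type*} [Fintype K] (v : K → ℝ) {c : ℝ}
    (h : ∀ w : EuclideanSpace ℝ K, ‖w‖ ≤ 1 → |∑ k, v k * w k| ≤ c) : ∑ k, v k ^ 2 ≤ c ^ 2 := by
  set V : EuclideanSpace ℝ K := WithLp.toLp 2 v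
  have hV : ‖V‖ ^ 2 = ∑ k, v k ^ 2 := by simp [EuclideanSpace.norm_sq_eq, V]
  rw [← hV]
  have hle : ‖V‖ ≤ c := by
    rcases eq_or_ne V 0 with h0 | h0
    · have := h 0 (by simp)
      rw [h0, norm_zero]; exact (abs_nonneg _).trans this
    · have hp : 0 < ‖V‖ := norm_pos_iff.2 h0
      have h1 := h (‖V‖⁻¹ • V) (by rw [norm_smul, norm_inv, norm_norm]; field_simp; rfl)
      have e : ∑ k, v k * (‖V‖⁻¹ • V) k = ‖V‖ := by
        have : ∑ k, v k * (‖V‖⁻¹ • V) k = ‖V‖⁻¹ * ∑ k, v k ^ 2 := by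
          rw [Finset.mul_sum]
          exact Finset.sum_congr rfl fun k _ => by simp [V]; ring
        rw [this, ← hV]; field_simp
      rw [e, abs_of_pos hp] at h1
      exact h1
  gcongr

/-! ### Random sign tensors tested on low-rank factorizations. -/

section

variable {ι : Type*} [Fintype ι] [DecidableEq ι]

theorem card_Icc_triple (N : ℕ) :
    Fintype.card (Finset.Icc 1 N × Finset.Icc 1 N × Finset.Icc 1 N) ≤ N ^ 3 := by
  simp only [Fintype.card_prod, Fintype.card_coe, Nat.card_Icc]
  simp only [Nat.add_sub_cancel]; apply le_of_eq; ring

/-- There is a sign tensor whose contractions by matrices of operator norm at most one have the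
Euclidean norm of a typical random tensor. -/
theorem exists_signs_contraction_le (ι : Type*) [Fintype ι] [DecidableEq ι] :
    ∃ g : ι × ι × ι → ℝ, (∀ p, g p = 1 ∨ g p = -1) ∧
      ∀ r ∈ Finset.Icc 1 (Fintype.card ι), ∀ s ∈ Finset.Icc 1 (Fintype.card ι),
      ∀ t ∈ Finset.Icc 1 (Fintype.card ι),
      ∀ (U : Matrix ι (Fin r) ℝ) (V : Matrix ι (Fin s) ℝ) (W : Matrix ι (Fin t) ℝ),
        ‖U‖ ≤ 1 → ‖V‖ ≤ 1 → ‖W‖ ≤ 1 →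
        ∑ p, ((U ⊗ₖ (V ⊗ₖ W))ᵀ *ᵥ g) p ^ 2 ≤
          (16 * Real.sqrt (8 * (r * s * t + Fintype.card ι * (r + s + t) : ℕ))) ^ 2 := by
  classical
  set N := Fintype.card ι with hN
  choose SM hM1 hM2 hM3 using fun r : ℕ => exists_finset_net (Matrix ι (Fin r) ℝ)
  choose SE hE1 hE2 hE3 using fun r s t : ℕ =>
    exists_finset_net (EuclideanSpace ℝ (Fin r × Fin s × Fin t))
  have H1 : ∀ i : Finset.Icc 1 N × Finset.Icc 1 N × Finset.Icc 1 N,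
      N + 1 ≤ i.1.1 * i.2.1.1 * i.2.2.1 + N * (i.1.1 + i.2.1.1 + i.2.2.1) := by
    rintro ⟨⟨r, hr⟩, ⟨s, hs⟩, ⟨t, ht⟩⟩
    simp only [Finset.mem_Icc] at hr hs ht ⊢
    have := Nat.mul_le_mul_left N (show 1 ≤ r + s + t by omega)
    have : 0 < r * s * t := Nat.mul_pos (Nat.mul_pos hr.1 hs.1) ht.1
    omega
  -- The exponent adds up dimensions: `rst` for the Euclidean test vector, and `Nr`, `Ns`, `Nt` for
  -- the three matrices.
  have H2 : ∀ i : Finset.Icc 1 N × Finset.Icc 1 N × Finset.Icc 1 N,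
      Fintype.card (SE i.1 i.2.1 i.2.2 × SM i.1 × SM i.2.1 × SM i.2.2) ≤
        5 ^ (i.1.1 * i.2.1.1 * i.2.2.1 + N * (i.1.1 + i.2.1.1 + i.2.2.1)) := by
    rintro ⟨⟨r, hr⟩, ⟨s, hs⟩, ⟨t, ht⟩⟩
    simp only [Fintype.card_prod, Fintype.card_coe]
    have e1 := hE1 r s t
    have e2 := hM1 r
    have e3 := hM1 s
    have e4 := hM1 t
    rw [finrank_euclideanSpace, Fintype.card_prod, Fintype.card_prod] at e1
    rw [Module.finrank_matrix, Module.finrank_self] at e2 e3 e4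
    simp only [Fintype.card_fin, mul_one, ← hN] at e1 e2 e3 e4
    calc _ ≤ 5 ^ (r * (s * t)) * (5 ^ (N * r) * (5 ^ (N * s) * 5 ^ (N * t))) := by gcongr
      _ = _ := by rw [← pow_add, ← pow_add, ← pow_add]; congr 1; ring
  have H3 : ∀ (i : Finset.Icc 1 N × Finset.Icc 1 N × Finset.Icc 1 N)
      (j : SE i.1 i.2.1 i.2.2 × SM i.1 × SM i.2.1 × SM i.2.2),
      ∑ k, ((j.2.1.1 ⊗ₖ (j.2.2.1.1 ⊗ₖ j.2.2.2.1)) *ᵥ j.1.1.ofLp) k ^ 2 ≤ (1 : ℝ) ^ 2 := by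
    rintro ⟨⟨r, hr⟩, ⟨s, hs⟩, ⟨t, ht⟩⟩ ⟨⟨w, hw⟩, ⟨U, hU⟩, ⟨V, hV⟩, ⟨W, hW⟩⟩
    rw [one_pow]
    refine (sum_sq_mulVec_le _ _).trans ?_
    have h1 := l2_opNorm_kronecker_le_one (hM2 r U hU) (hM2 s V hV) (hM2 t W hW)
    have h2 := hE2 r s t w hw
    have h3 : ∑ j, w.ofLp j ^ 2 = ‖w‖ ^ 2 := by simp [EuclideanSpace.norm_sq_eq]
    rw [h3, ← mul_pow]
    exact pow_le_one₀ (by positivity) (mul_le_one₀ h1 (norm_nonneg _) h2)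
  obtain ⟨g, hg, hb⟩ := exists_signs_of_card_le (K := ι × ι × ι)
    (ι := Finset.Icc 1 N × Finset.Icc 1 N × Finset.Icc 1 N)
    (J := fun i => SE i.1 i.2.1 i.2.2 × SM i.1 × SM i.2.1 × SM i.2.2) N (card_Icc_triple N)
    (fun i => i.1 * i.2.1 * i.2.2 + N * (i.1 + i.2.1 + i.2.2)) H1 H2
    (fun i j => (j.2.1.1 ⊗ₖ (j.2.2.1.1 ⊗ₖ j.2.2.2.1)) *ᵥ j.1.1.ofLp) (fun _ => 1)
    (fun _ => one_pos) H3
  refine ⟨g, hg, fun r hr s hs t ht U V W hU hV hW => ?_⟩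
  set c := Real.sqrt (8 * (r * s * t + N * (r + s + t) : ℕ))
  have h0 : ∀ w ∈ SE r s t, ∀ U ∈ SM r, ∀ V ∈ SM s, ∀ W ∈ SM t,
      |∑ k, g k * ((U ⊗ₖ (V ⊗ₖ W)) *ᵥ w.ofLp) k| ≤ c := by
    intro w hw U hU V hV W hW
    simpa only [one_mul] using hb (⟨r, hr⟩, ⟨s, hs⟩, ⟨t, ht⟩) (⟨w, hw⟩, ⟨U, hU⟩, ⟨V, hV⟩, ⟨W, hW⟩)
  -- The form is linear in `W`, `V`, `U` and `w` separately. Passing from net to ball doubles the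
  -- bound each time, whence `16 = 2⁴`.
  have h1 : ∀ w ∈ SE r s t, ∀ U ∈ SM r, ∀ V ∈ SM s, ∀ W, ‖W‖ ≤ 1 →
      |∑ k, g k * ((U ⊗ₖ (V ⊗ₖ W)) *ᵥ w.ofLp) k| ≤ 2 * c := fun w hw U hU V hV =>
    hM3 t _ ⟨fun x y => by
        simp [kronecker_add, add_mulVec, mul_add, Finset.sum_add_distrib],
      fun a x => by
        simp [kronecker_smul, smul_mulVec, Finset.mul_sum, mul_left_comm]⟩ c (h0 w hw U hU V hV)
  have h2 : ∀ w ∈ SE r s t, ∀ U ∈ SM r, ∀ V, ‖V‖ ≤ 1 → ∀ W, ‖W‖ ≤ 1 →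
      |∑ k, g k * ((U ⊗ₖ (V ⊗ₖ W)) *ᵥ w.ofLp) k| ≤ 2 * (2 * c) := fun w hw U hU V hV W hW =>
    hM3 s (fun V => ∑ k, g k * ((U ⊗ₖ (V ⊗ₖ W)) *ᵥ w.ofLp) k) ⟨fun x y => by
        simp [kronecker_add, add_kronecker, add_mulVec, mul_add, Finset.sum_add_distrib],
      fun a x => by
        simp [kronecker_smul, smul_kronecker, smul_mulVec, Finset.mul_sum, mul_left_comm]⟩ _
      (fun V hV => h1 w hw U hU V hV W hW) V hV
  have h3 : ∀ w ∈ SE r s t, ∀ U, ‖U‖ ≤ 1 → ∀ V, ‖V‖ ≤ 1 → ∀ W, ‖W‖ ≤ 1 →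
      |∑ k, g k * ((U ⊗ₖ (V ⊗ₖ W)) *ᵥ w.ofLp) k| ≤ 2 * (2 * (2 * c)) :=
    fun w hw U hU V hV W hW =>
    hM3 r (fun U => ∑ k, g k * ((U ⊗ₖ (V ⊗ₖ W)) *ᵥ w.ofLp) k) ⟨fun x y => by
        simp [add_kronecker, add_mulVec, mul_add, Finset.sum_add_distrib],
      fun a x => by
        simp [smul_kronecker, smul_mulVec, Finset.mul_sum, mul_left_comm]⟩ _
      (fun U hU => h2 w hw U hU V hV W hW) U hU
  have h4 : ∀ w : EuclideanSpace ℝ (Fin r × Fin s × Fin t), ‖w‖ ≤ 1 →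
      |∑ k, g k * ((U ⊗ₖ (V ⊗ₖ W)) *ᵥ w.ofLp) k| ≤ 2 * (2 * (2 * (2 * c))) :=
    fun w hw =>
    hE3 r s t (fun w => ∑ k, g k * ((U ⊗ₖ (V ⊗ₖ W)) *ᵥ w.ofLp) k) ⟨fun x y => by
        simp [mulVec_add, mul_add, Finset.sum_add_distrib],
      fun a x => by
        simp [mulVec_smul, Finset.mul_sum, mul_left_comm]⟩ _
      (fun w hw' => h3 w hw' U hU V hV W hW) w hw
  refine sum_sq_le_of_forall_abs_sum_le _ fun w hw => ?_
  have e : ∑ k, ((U ⊗ₖ (V ⊗ₖ W))ᵀ *ᵥ g) k * w k =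
      ∑ k, g k * ((U ⊗ₖ (V ⊗ₖ W)) *ᵥ w.ofLp) k := by
    change ((U ⊗ₖ (V ⊗ₖ W))ᵀ *ᵥ g) ⬝ᵥ w.ofLp = g ⬝ᵥ ((U ⊗ₖ (V ⊗ₖ W)) *ᵥ w.ofLp)
    rw [dotProduct_mulVec, mulVec_transpose]
  rw [e]
  exact (h4 w hw).trans (le_of_eq (by ring))

/-- Given `h'` as in `exists_signs_contraction_le`, a second sign tensor `g` makes the trilinear
form `(X, Y, Z) ↦ ⟨g, (X ⊗ Y ⊗ Z) g'⟩` small on factored matrices. -/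
theorem exists_signs_form_le (ι : Type*) [Fintype ι] [DecidableEq ι] (h' : ι × ι × ι → ℝ)
    (hh : ∀ r ∈ Finset.Icc 1 (Fintype.card ι), ∀ s ∈ Finset.Icc 1 (Fintype.card ι),
      ∀ t ∈ Finset.Icc 1 (Fintype.card ι),
      ∀ (U : Matrix ι (Fin r) ℝ) (V : Matrix ι (Fin s) ℝ) (W : Matrix ι (Fin t) ℝ),
        ‖U‖ ≤ 1 → ‖V‖ ≤ 1 → ‖W‖ ≤ 1 →
        ∑ p, ((U ⊗ₖ (V ⊗ₖ W))ᵀ *ᵥ h') p ^ 2 ≤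
          (16 * Real.sqrt (8 * (r * s * t + Fintype.card ι * (r + s + t) : ℕ))) ^ 2) :
    ∃ g : ι × ι × ι → ℝ, (∀ p, g p = 1 ∨ g p = -1) ∧
      ∀ r ∈ Finset.Icc 1 (Fintype.card ι), ∀ s ∈ Finset.Icc 1 (Fintype.card ι),
      ∀ t ∈ Finset.Icc 1 (Fintype.card ι),
      ∀ (U U' : Matrix ι (Fin r) ℝ) (V V' : Matrix ι (Fin s) ℝ) (W W' : Matrix ι (Fin t) ℝ),
        ‖U‖ ≤ 1 → ‖U'‖ ≤ 1 → ‖V‖ ≤ 1 → ‖V'‖ ≤ 1 → ‖W‖ ≤ 1 → ‖W'‖ ≤ 1 →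
        |∑ p, g p * ((U ⊗ₖ (V ⊗ₖ W)) *ᵥ ((U' ⊗ₖ (V' ⊗ₖ W'))ᵀ *ᵥ h')) p| ≤
          64 * (16 * Real.sqrt (8 * (r * s * t + Fintype.card ι * (r + s + t) : ℕ)) *
            Real.sqrt (8 * (2 * (Fintype.card ι * (r + s + t)) : ℕ))) := by
  classical
  set N := Fintype.card ι with hN
  choose SM hM1 hM2 hM3 using fun r : ℕ => exists_finset_net (Matrix ι (Fin r) ℝ)
  have hpos : ∀ i : Finset.Icc 1 N × Finset.Icc 1 N × Finset.Icc 1 N, 1 ≤ N ∧ 1 ≤ i.1.1 ∧ 1 ≤ i.2.1.1 ∧ 1 ≤ i.2.2.1 ∧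
      0 < i.1.1 * i.2.1.1 * i.2.2.1 := by
    rintro ⟨⟨r, hr⟩, ⟨s, hs⟩, ⟨t, ht⟩⟩
    simp only [Finset.mem_Icc] at hr hs ht ⊢
    exact ⟨hr.1.trans hr.2, hr.1, hs.1, ht.1, Nat.mul_pos (Nat.mul_pos hr.1 hs.1) ht.1⟩
  have H1 : ∀ i : Finset.Icc 1 N × Finset.Icc 1 N × Finset.Icc 1 N,
      N + 1 ≤ 2 * (N * (i.1.1 + i.2.1.1 + i.2.2.1)) := by
    intro i
    obtain ⟨a, b, c, d, -⟩ := hpos i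
    have := Nat.mul_le_mul_left N (show 1 ≤ i.1.1 + i.2.1.1 + i.2.2.1 by omega)
    omega
  have H2 : ∀ i : Finset.Icc 1 N × Finset.Icc 1 N × Finset.Icc 1 N,
      Fintype.card ((SM i.1 × SM i.1) × (SM i.2.1 × SM i.2.1) × (SM i.2.2 × SM i.2.2)) ≤
        5 ^ (2 * (N * (i.1.1 + i.2.1.1 + i.2.2.1))) := by
    rintro ⟨⟨r, hr⟩, ⟨s, hs⟩, ⟨t, ht⟩⟩
    simp only [Fintype.card_prod, Fintype.card_coe]
    have e2 := hM1 r
    have e3 := hM1 s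
    have e4 := hM1 t
    rw [Module.finrank_matrix, Module.finrank_self] at e2 e3 e4
    simp only [Fintype.card_fin, mul_one, ← hN] at e2 e3 e4
    calc _ ≤ (5 ^ (N * r) * 5 ^ (N * r)) * ((5 ^ (N * s) * 5 ^ (N * s)) *
          (5 ^ (N * t) * 5 ^ (N * t))) := by gcongr
      _ = _ := by simp only [← pow_add]; congr 1; ring
  have H3 : ∀ i : Finset.Icc 1 N × Finset.Icc 1 N × Finset.Icc 1 N,
      0 < 16 * Real.sqrt
        (8 * (i.1.1 * i.2.1.1 * i.2.2.1 + N * (i.1.1 + i.2.1.1 + i.2.2.1) : ℕ)) := by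
    intro i
    obtain ⟨a, b, c, d, e⟩ := hpos i
    have : (0 : ℝ) < (i.1.1 * i.2.1.1 * i.2.2.1 + N * (i.1.1 + i.2.1.1 + i.2.2.1) : ℕ) := by
      exact_mod_cast Nat.add_pos_left e _
    positivity
  -- The already fixed `h'` supplies the variance: its contraction is short by `hh`, and the outer
  -- Kronecker product does not lengthen it. Only matrices are discretized at this stage, so the net
  -- exponent has no `rst` term.
  have H4 : ∀ (i : Finset.Icc 1 N × Finset.Icc 1 N × Finset.Icc 1 N)
      (j : (SM i.1 × SM i.1) × (SM i.2.1 × SM i.2.1) × (SM i.2.2 × SM i.2.2)),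
      ∑ k, ((j.1.1.1 ⊗ₖ (j.2.1.1.1 ⊗ₖ j.2.2.1.1)) *ᵥ
        ((j.1.2.1 ⊗ₖ (j.2.1.2.1 ⊗ₖ j.2.2.2.1))ᵀ *ᵥ h')) k ^ 2 ≤
      (16 * Real.sqrt
        (8 * (i.1.1 * i.2.1.1 * i.2.2.1 + N * (i.1.1 + i.2.1.1 + i.2.2.1) : ℕ))) ^ 2 := by
    rintro ⟨⟨r, hr⟩, ⟨s, hs⟩, ⟨t, ht⟩⟩ ⟨⟨⟨U, hU⟩, ⟨U', hU'⟩⟩, ⟨⟨V, hV⟩, ⟨V', hV'⟩⟩, ⟨W, hW⟩, ⟨W', hW'⟩⟩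
    refine (sum_sq_mulVec_le _ _).trans ?_
    have h1 := l2_opNorm_kronecker_le_one (hM2 r U hU) (hM2 s V hV) (hM2 t W hW)
    have h2 := hh r hr s hs t ht U' V' W' (hM2 r U' hU') (hM2 s V' hV') (hM2 t W' hW')
    refine le_trans ?_ h2
    exact mul_le_of_le_one_left (Finset.sum_nonneg fun _ _ => sq_nonneg _)
      (pow_le_one₀ (norm_nonneg _) h1)
  obtain ⟨g, hg, hb⟩ := exists_signs_of_card_le (K := ι × ι × ι)
    (ι := Finset.Icc 1 N × Finset.Icc 1 N × Finset.Icc 1 N)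
    (J := fun i => (SM i.1 × SM i.1) × (SM i.2.1 × SM i.2.1) × (SM i.2.2 × SM i.2.2)) N
    (card_Icc_triple N)
    (fun i => 2 * (N * (i.1 + i.2.1 + i.2.2))) H1 H2
    (fun i j => (j.1.1.1 ⊗ₖ (j.2.1.1.1 ⊗ₖ j.2.2.1.1)) *ᵥ
      ((j.1.2.1 ⊗ₖ (j.2.1.2.1 ⊗ₖ j.2.2.2.1))ᵀ *ᵥ h'))
    (fun i => 16 * Real.sqrt (8 * (i.1 * i.2.1 * i.2.2 + N * (i.1 + i.2.1 + i.2.2) : ℕ))) H3 H4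
  refine ⟨g, hg, fun r hr s hs t ht U U' V V' W W' hU hU' hV hV' hW hW' => ?_⟩
  set c := 16 * Real.sqrt (8 * (r * s * t + N * (r + s + t) : ℕ)) *
    Real.sqrt (8 * (2 * (N * (r + s + t)) : ℕ))
  let f : Matrix ι (Fin r) ℝ → Matrix ι (Fin r) ℝ → Matrix ι (Fin s) ℝ →
    Matrix ι (Fin s) ℝ → Matrix ι (Fin t) ℝ → Matrix ι (Fin t) ℝ → ℝ :=
    fun U U' V V' W W' =>
      ∑ p, g p * ((U ⊗ₖ (V ⊗ₖ W)) *ᵥ ((U' ⊗ₖ (V' ⊗ₖ W'))ᵀ *ᵥ h')) p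
  have h0 : ∀ U ∈ SM r, ∀ U' ∈ SM r, ∀ V ∈ SM s, ∀ V' ∈ SM s, ∀ W ∈ SM t, ∀ W' ∈ SM t,
      |f U U' V V' W W'| ≤ c := by
    intro U hU U' hU' V hV V' hV' W hW W' hW'
    exact hb (⟨r, hr⟩, ⟨s, hs⟩, ⟨t, ht⟩)
      ((⟨U, hU⟩, ⟨U', hU'⟩), (⟨V, hV⟩, ⟨V', hV'⟩), (⟨W, hW⟩, ⟨W', hW'⟩))
  -- Six linear arguments leave their nets one by one, which accounts for `64 = 2⁶`.
  have h1 : ∀ U ∈ SM r, ∀ U' ∈ SM r, ∀ V ∈ SM s, ∀ V' ∈ SM s, ∀ W ∈ SM t, ∀ W', ‖W'‖ ≤ 1 →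
      |f U U' V V' W W'| ≤ 2 * c := fun U hU U' hU' V hV V' hV' W hW W' hW' =>
    hM3 t (fun W' => f U U' V V' W W') ⟨fun x y => by
        simp [f, kronecker_add, add_mulVec, Matrix.mul_add, mul_add, Finset.sum_add_distrib],
      fun a x => by
        simp [f, kronecker_smul, smul_mulVec, Finset.mul_sum, mul_left_comm]⟩ _
      (fun W' hW' => h0 U hU U' hU' V hV V' hV' W hW W' hW') W' hW'
  have h2 : ∀ U ∈ SM r, ∀ U' ∈ SM r, ∀ V ∈ SM s, ∀ V' ∈ SM s, ∀ W, ‖W‖ ≤ 1 → ∀ W', ‖W'‖ ≤ 1 →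
      |f U U' V V' W W'| ≤ 2 * (2 * c) := fun U hU U' hU' V hV V' hV' W hW W' hW' =>
    hM3 t (fun W => f U U' V V' W W') ⟨fun x y => by
        simp [f, kronecker_add, add_mulVec, Matrix.add_mul, mul_add, Finset.sum_add_distrib],
      fun a x => by
        simp [f, kronecker_smul, smul_mulVec, Finset.mul_sum, mul_left_comm]⟩ _
      (fun W hW => h1 U hU U' hU' V hV V' hV' W hW W' hW') W hW
  have h3 : ∀ U ∈ SM r, ∀ U' ∈ SM r, ∀ V ∈ SM s, ∀ V', ‖V'‖ ≤ 1 → ∀ W, ‖W‖ ≤ 1 →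
      ∀ W', ‖W'‖ ≤ 1 → |f U U' V V' W W'| ≤ 2 * (2 * (2 * c)) :=
    fun U hU U' hU' V hV V' hV' W hW W' hW' =>
    hM3 s (fun V' => f U U' V V' W W') ⟨fun x y => by
        simp [f, kronecker_add, add_kronecker, add_mulVec, Matrix.mul_add, mul_add,
          Finset.sum_add_distrib],
      fun a x => by
        simp [f, kronecker_smul, smul_kronecker, smul_mulVec, Finset.mul_sum,
          mul_left_comm]⟩ _
      (fun V' hV' => h2 U hU U' hU' V hV V' hV' W hW W' hW') V' hV'
  have h4 : ∀ U ∈ SM r, ∀ U' ∈ SM r, ∀ V, ‖V‖ ≤ 1 → ∀ V', ‖V'‖ ≤ 1 → ∀ W, ‖W‖ ≤ 1 →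
      ∀ W', ‖W'‖ ≤ 1 → |f U U' V V' W W'| ≤ 2 * (2 * (2 * (2 * c))) :=
    fun U hU U' hU' V hV V' hV' W hW W' hW' =>
    hM3 s (fun V => f U U' V V' W W') ⟨fun x y => by
        simp [f, kronecker_add, add_kronecker, add_mulVec, Matrix.add_mul, mul_add,
          Finset.sum_add_distrib],
      fun a x => by
        simp [f, kronecker_smul, smul_kronecker, smul_mulVec, Finset.mul_sum, mul_left_comm]⟩ _
      (fun V hV => h3 U hU U' hU' V hV V' hV' W hW W' hW') V hV
  have h5 : ∀ U ∈ SM r, ∀ U', ‖U'‖ ≤ 1 → ∀ V, ‖V‖ ≤ 1 → ∀ V', ‖V'‖ ≤ 1 → ∀ W, ‖W‖ ≤ 1 →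
      ∀ W', ‖W'‖ ≤ 1 → |f U U' V V' W W'| ≤ 2 * (2 * (2 * (2 * (2 * c)))) :=
    fun U hU U' hU' V hV V' hV' W hW W' hW' =>
    hM3 r (fun U' => f U U' V V' W W') ⟨fun x y => by
        simp [f, add_kronecker, add_mulVec, Matrix.mul_add, mul_add, Finset.sum_add_distrib],
      fun a x => by
        simp [f, smul_kronecker, smul_mulVec, Finset.mul_sum, mul_left_comm]⟩ _
      (fun U' hU' => h4 U hU U' hU' V hV V' hV' W hW W' hW') U' hU'
  have h6 : |f U U' V V' W W'| ≤ 2 * (2 * (2 * (2 * (2 * (2 * c))))) :=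
    hM3 r (fun U => f U U' V V' W W') ⟨fun x y => by
        simp [f, add_kronecker, add_mulVec, Matrix.add_mul, mul_add, Finset.sum_add_distrib],
      fun a x => by
        simp [f, smul_kronecker, smul_mulVec, Finset.mul_sum, mul_left_comm]⟩ _
      (fun U hU => h5 U hU U' hU' V hV V' hV' W hW W' hW') U hU
  exact h6.trans (le_of_eq (by ring))

end

/-! ### Algebra of the trilinear form, and spectral decompositions of matrices. -/

/-- The trilinear form `(X, Y, Z) ↦ ⟨g, (X ⊗ Y ⊗ Z) h⟩`. -/
def trilinForm {R ι : Type*} [CommSemiring R] [Fintype ι] (g h : ι × ι × ι → R)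
    (X Y Z : Matrix ι ι R) : R :=
  ∑ p, ∑ q, g p * (X p.1 q.1 * (Y p.2.1 q.2.1 * Z p.2.2 q.2.2)) * h q

section

variable {ι : Type*} [Fintype ι]

theorem trilinForm_eq_sum_mulVec (g h : ι × ι × ι → ℝ) (X Y Z : Matrix ι ι ℝ) :
    trilinForm g h X Y Z = ∑ p, g p * ((X ⊗ₖ (Y ⊗ₖ Z)) *ᵥ h) p := by
  simp only [trilinForm, mulVec, dotProduct, kroneckerMap_apply, Finset.mul_sum, mul_assoc]

/-- Permuting the tensor legs of `g` and `h` along with the arguments transfers statements about the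
first argument to the second; `trilinForm_swap_outer` does the same for the third. -/
theorem trilinForm_swap_left {R : Type*} [CommSemiring R] (g h : ι × ι × ι → R)
    (X Y Z : Matrix ι ι R) :
    trilinForm (fun p => g (p.2.1, p.1, p.2.2)) (fun p => h (p.2.1, p.1, p.2.2)) Y X Z =
      trilinForm g h X Y Z := by
  let e : ι × ι × ι ≃ ι × ι × ι :=
    ⟨fun p => (p.2.1, p.1, p.2.2), fun p => (p.2.1, p.1, p.2.2), fun _ => rfl, fun _ => rfl⟩
  refine Fintype.sum_equiv e _ _ fun p => Fintype.sum_equiv e _ _ fun q => ?_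
  simp only [e, Equiv.coe_fn_mk]
  ring

theorem trilinForm_swap_outer {R : Type*} [CommSemiring R] (g h : ι × ι × ι → R)
    (X Y Z : Matrix ι ι R) :
    trilinForm (fun p => g (p.2.2, p.2.1, p.1)) (fun p => h (p.2.2, p.2.1, p.1)) Z Y X =
      trilinForm g h X Y Z := by
  let e : ι × ι × ι ≃ ι × ι × ι :=
    ⟨fun p => (p.2.2, p.2.1, p.1), fun p => (p.2.2, p.2.1, p.1), fun _ => rfl, fun _ => rfl⟩
  refine Fintype.sum_equiv e _ _ fun p => Fintype.sum_equiv e _ _ fun q => ?_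
  simp only [e, Equiv.coe_fn_mk]
  ring

theorem trilinForm_sum_left {R κ : Type*} [CommSemiring R] (g h : ι × ι × ι → R) (S : Finset κ)
    (A : κ → Matrix ι ι R) (Y Z : Matrix ι ι R) :
    trilinForm g h (∑ k ∈ S, A k) Y Z = ∑ k ∈ S, trilinForm g h (A k) Y Z := by
  simp only [trilinForm, Matrix.sum_apply, Finset.sum_mul, Finset.mul_sum]
  exact (Finset.sum_congr rfl fun p _ => Finset.sum_comm).trans Finset.sum_comm

theorem trilinForm_smul_left {R : Type*} [CommSemiring R] (g h : ι × ι × ι → R) (c : R)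
    (X Y Z : Matrix ι ι R) :
    trilinForm g h (c • X) Y Z = c * trilinForm g h X Y Z := by
  simp only [trilinForm, Matrix.smul_apply, smul_eq_mul, Finset.mul_sum]
  exact Finset.sum_congr rfl fun p _ => Finset.sum_congr rfl fun q _ => by ring

theorem trilinForm_sum_sum_sum {R κ : Type*} [CommSemiring R] (g h : ι × ι × ι → R)
    (S : Finset κ) (A B C : κ → Matrix ι ι R) :
    trilinForm g h (∑ k ∈ S, A k) (∑ k ∈ S, B k) (∑ k ∈ S, C k) =
      ∑ k ∈ S, ∑ l ∈ S, ∑ m ∈ S, trilinForm g h (A k) (B l) (C m) := by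
  rw [trilinForm_sum_left]
  refine Finset.sum_congr rfl fun k _ => ?_
  rw [← trilinForm_swap_left, trilinForm_sum_left]
  refine Finset.sum_congr rfl fun l _ => ?_
  rw [trilinForm_swap_left, ← trilinForm_swap_outer, trilinForm_sum_left]
  refine Finset.sum_congr rfl fun m _ => ?_
  rw [trilinForm_swap_outer]

theorem trilinForm_smul_smul_smul {R : Type*} [CommSemiring R] (g h : ι × ι × ι → R) (a b c : R)
    (X Y Z : Matrix ι ι R) :
    trilinForm g h (a • X) (b • Y) (c • Z) = a * b * c * trilinForm g h X Y Z := by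
  simp only [trilinForm, Matrix.smul_apply, smul_eq_mul, Finset.mul_sum]
  exact Finset.sum_congr rfl fun p _ => Finset.sum_congr rfl fun q _ => by ring

/-- The matrix representing the linear form `X ↦ trilinForm g h X Y Z`. -/
def trilinFormSlice (g h : ι × ι × ι → ℝ) (Y Z : Matrix ι ι ℝ) : Matrix ι ι ℝ :=
  (of fun (i : ι) (p : ι × ι) => g (i, p)) * (Y ⊗ₖ Z) *
    (of fun (i : ι) (p : ι × ι) => h (i, p))ᵀ

theorem trilinForm_eq_trace (g h : ι × ι × ι → ℝ) (X Y Z : Matrix ι ι ℝ) :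
    trilinForm g h X Y Z = (Xᵀ * trilinFormSlice g h Y Z).trace := by
  have e : trilinForm g h X Y Z = ∑ i, ∑ u : ι × ι, ∑ i', ∑ v : ι × ι,
      g (i, u) * (X i i' * (Y u.1 v.1 * Z u.2 v.2)) * h (i', v) := by
    simp only [trilinForm, Fintype.sum_prod_type (α₁ := ι) (α₂ := ι × ι)]
  have e' : ∑ i, ∑ u : ι × ι, ∑ i', ∑ v : ι × ι,
      g (i, u) * (X i i' * (Y u.1 v.1 * Z u.2 v.2)) * h (i', v) =
      ∑ i', ∑ i, ∑ v : ι × ι, ∑ u : ι × ι,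
      g (i, u) * (X i i' * (Y u.1 v.1 * Z u.2 v.2)) * h (i', v) := by
    rw [Finset.sum_comm (s := (Finset.univ : Finset ι)) (t := (Finset.univ : Finset ι))]
    refine Finset.sum_congr rfl fun i _ => ?_
    rw [Finset.sum_comm]
    exact Finset.sum_congr rfl fun i' _ => Finset.sum_comm
  rw [e, e']
  simp only [trilinFormSlice, trace, diag_apply, mul_apply, transpose_apply, of_apply,
    kroneckerMap_apply, Finset.mul_sum, Finset.sum_mul]
  exact Finset.sum_congr rfl fun i' _ => Finset.sum_congr rfl fun i _ =>
    Finset.sum_congr rfl fun v _ => Finset.sum_congr rfl fun u _ => by ring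

variable [DecidableEq ι]

theorem l2_opNorm_le_of_transpose_mul_self {m n : Type*} [Fintype m] [Fintype n] [DecidableEq n]
    (A : Matrix m n ℝ) (d : n → ℝ) {c : ℝ} (hc : 0 ≤ c) (h : Aᵀ * A = diagonal d)
    (hd : ∀ i, |d i| ≤ c ^ 2) : ‖A‖ ≤ c := by
  have h1 := l2_opNorm_conjTranspose_mul_self A
  rw [conjTranspose_eq_transpose_of_trivial, h, l2_opNorm_diagonal] at h1
  have h2 : ‖d‖ ≤ c ^ 2 := (pi_norm_le_iff_of_nonneg (sq_nonneg c)).2 hd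
  rw [h1, ← sq] at h2
  exact (sq_le_sq₀ (norm_nonneg _) hc).1 h2

/-- A singular value decomposition in usable form: the columns of `W` are right singular vectors and
`ev` lists the squared singular values, whose sum is the trace of `Mᵀ * M`. -/
theorem exists_spectral (M : Matrix ι ι ℝ) :
    ∃ (W : Matrix ι ι ℝ) (ev : ι → ℝ), Wᵀ * W = 1 ∧ W * Wᵀ = 1 ∧
      Mᵀ * M = W * diagonal ev * Wᵀ ∧ (∀ i, 0 ≤ ev i) ∧ ∑ i, ev i = ∑ i, ∑ j, M i j ^ 2 ∧
      Fintype.card {i // ev i ≠ 0} = M.rank := by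
  have hA : (Mᵀ * M).IsHermitian := by
    rw [← conjTranspose_eq_transpose_of_trivial]; exact isHermitian_conjTranspose_mul_self M
  have hps : (Mᵀ * M).PosSemidef := by
    rw [← conjTranspose_eq_transpose_of_trivial]; exact posSemidef_conjTranspose_mul_self M
  refine ⟨hA.eigenvectorUnitary, hA.eigenvalues, ?_, ?_, ?_, ?_, ?_, ?_⟩
  · have := Unitary.star_mul_self_of_mem hA.eigenvectorUnitary.2
    rwa [star_eq_conjTranspose, conjTranspose_eq_transpose_of_trivial] at this
  · have := Unitary.mul_star_self_of_mem hA.eigenvectorUnitary.2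
    rwa [star_eq_conjTranspose, conjTranspose_eq_transpose_of_trivial] at this
  · have := hA.spectral_theorem
    rw [Unitary.conjStarAlgAut_apply, star_eq_conjTranspose,
      conjTranspose_eq_transpose_of_trivial] at this
    exact this
  · exact hps.eigenvalues_nonneg
  · have := hA.trace_eq_sum_eigenvalues
    simp only [RCLike.ofReal_real_eq_id, id_eq] at this
    rw [← this, trace, Finset.sum_comm]
    refine Finset.sum_congr rfl fun i _ => ?_
    simp [mul_apply, sq]
  · rw [← hA.rank_eq_card_non_zero_eigs, rank_transpose_mul_self]

/-- Restricting `M` to a spectral subspace of `Mᵀ * M`. -/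
theorem transpose_mul_self_spectral_restrict {M W : Matrix ι ι ℝ} {ev : ι → ℝ}
    (hW : Wᵀ * W = 1) (hM : Mᵀ * M = W * diagonal ev * Wᵀ) (d : ι → ℝ) :
    (M * (W * diagonal d))ᵀ * (M * (W * diagonal d)) = diagonal (fun i => d i * ev i * d i) := by
  calc (M * (W * diagonal d))ᵀ * (M * (W * diagonal d))
      = diagonal d * Wᵀ * (Mᵀ * M) * (W * diagonal d) := by
        simp only [transpose_mul, diagonal_transpose, Matrix.mul_assoc]
    _ = diagonal d * (Wᵀ * W) * diagonal ev * (Wᵀ * W) * diagonal d := by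
        rw [hM]; simp only [Matrix.mul_assoc]
    _ = _ := by
        rw [hW]; simp only [Matrix.mul_one, diagonal_mul_diagonal]

theorem l2_opNorm_le_one_of_transpose_mul_self {W : Matrix ι ι ℝ} (hW : Wᵀ * W = 1) : ‖W‖ ≤ 1 :=
  l2_opNorm_le_of_transpose_mul_self W (fun _ => 1) zero_le_one (by rw [hW, diagonal_one])
    (by simp)

/-- Take as columns of `Q` the eigenvectors of `Mᵀ * M` with nonzero eigenvalue, padded by zero
columns to width `q`. Then `Q * Qᵀ` is the projection onto their span, and `M` kills the complement.
Low rank thus becomes a factorization `(M * Q) * Qᵀ` through thin matrices. -/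
theorem exists_mul_mul_transpose_eq_self (M : Matrix ι ι ℝ) {q : ℕ} (hq : M.rank ≤ q) :
    ∃ Q : Matrix ι (Fin q) ℝ, ‖Q‖ ≤ 1 ∧ M * (Q * Qᵀ) = M := by
  obtain ⟨W, ev, hW1, hW2, hM, -, -, hr⟩ := exists_spectral M
  obtain ⟨f⟩ : Nonempty ({i // ev i ≠ 0} ↪ Fin q) :=
    Function.Embedding.nonempty_of_card_le (by rw [hr, Fintype.card_fin]; exact hq)
  let E : Matrix ι (Fin q) ℝ :=
    of fun i a => if h : ev i ≠ 0 then (if f ⟨i, h⟩ = a then 1 else 0) else 0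
  let d : ι → ℝ := fun i => if ev i ≠ 0 then 1 else 0
  have hE : E * Eᵀ = diagonal d := by
    ext i j
    simp only [mul_apply, transpose_apply, E, of_apply]
    by_cases hi : ev i ≠ 0
    · by_cases hj : ev j ≠ 0
      · by_cases hij : i = j
        · subst hij
          simp [d, hi]
        · simp [hi, hj, hij]
      · have hij : i ≠ j := by rintro rfl; exact hj hi
        simp [hj, hij]
    · by_cases hij : i = j
      · subst hij
        simp [d, hi]
      · simp [hi, hij]
  have hEn : ‖E‖ ≤ 1 := by
    rw [← l2_opNorm_transpose_real]
    refine l2_opNorm_le_of_transpose_mul_self Eᵀ d zero_le_one (by rw [transpose_transpose, hE]) ?_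
    intro i
    simp only [d]; split_ifs <;> simp
  refine ⟨W * E, ?_, ?_⟩
  · exact (l2_opNorm_mul _ _).trans
      (mul_le_one₀ (l2_opNorm_le_one_of_transpose_mul_self hW1) (norm_nonneg _) hEn)
  · have hP : W * E * (W * E)ᵀ = W * diagonal d * Wᵀ := by
      rw [transpose_mul, ← hE]; simp only [Matrix.mul_assoc]
    have h0 : M * (W * diagonal (fun i => 1 - d i)) = 0 := by
      rw [← conjTranspose_mul_self_eq_zero, conjTranspose_eq_transpose_of_trivial,
        transpose_mul_self_spectral_restrict hW1 hM, ← diagonal_zero]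
      congr 1
      ext i
      by_cases hi : ev i = 0 <;> simp [d, hi]
    have h1 : W * diagonal (fun i => 1 - d i) * Wᵀ = 1 - W * diagonal d * Wᵀ := by
      have : diagonal (fun i => 1 - d i) = 1 - diagonal d := by
        rw [← diagonal_one, diagonal_sub]
      rw [this, Matrix.mul_sub, Matrix.sub_mul, Matrix.mul_one, hW2]
    have h2 : M * (1 - W * diagonal d * Wᵀ) = 0 := by
      rw [← h1, ← Matrix.mul_assoc, h0, Matrix.zero_mul]
    rw [hP]
    rw [Matrix.mul_sub, Matrix.mul_one, sub_eq_zero] at h2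
    exact h2.symm

/-- A matrix splits into `L + 1` pieces which are nearly flat on their rank. -/
theorem exists_sum_eq_rank_mul_norm_sq_le (X : Matrix ι ι ℝ) (L : ℕ)
    (hL : Fintype.card ι ≤ 4 ^ L) :
    ∃ A : ℕ → Matrix ι ι ℝ, X = ∑ k ∈ Finset.range (L + 1), A k ∧
      ∑ k ∈ Finset.range (L + 1), ((A k).rank : ℝ) * ‖A k‖ ^ 2 ≤ 5 * ∑ i, ∑ j, X i j ^ 2 := by
  classical
  obtain ⟨W, ev, hW1, hW2, hM, hev, hF, -⟩ := exists_spectral X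
  rw [← hF]
  set F := ∑ i, ev i
  have hF0 : 0 ≤ F := Finset.sum_nonneg fun i _ => hev i
  have hevF : ∀ i, ev i ≤ F := fun i =>
    Finset.single_le_sum (fun j _ => hev j) (Finset.mem_univ i)
  -- Level `k < L` collects the squared singular values in `(F / 4^(k+1), F / 4^k]`; level `L`
  -- collects all that are at most `F / 4^L`.
  let lev : ι → ℕ := fun i => Nat.findGreatest (fun k => ev i ≤ F / 4 ^ k) L
  have hlev : ∀ i, lev i ≤ L := fun i => Nat.findGreatest_le _
  have h1 : ∀ i, ev i ≤ F / 4 ^ lev i := fun i =>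
    Nat.findGreatest_spec (P := fun k => ev i ≤ F / 4 ^ k) (Nat.zero_le L) (by simpa using hevF i)
  have h2 : ∀ i, lev i < L → F / 4 ^ (lev i + 1) < ev i := by
    intro i hi
    by_contra! hc
    have : lev i + 1 ≤ lev i :=
      Nat.le_findGreatest (P := fun k => ev i ≤ F / 4 ^ k) hi hc
    omega
  let d : ℕ → ι → ℝ := fun k i => if lev i = k then 1 else 0
  let A : ℕ → Matrix ι ι ℝ := fun k => X * (W * diagonal (d k)) * Wᵀ
  have hnorm : ∀ k, ‖A k‖ ^ 2 ≤ F / 4 ^ k := by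
    intro k
    have a1 : ‖X * (W * diagonal (d k))‖ ≤ Real.sqrt (F / 4 ^ k) := by
      refine l2_opNorm_le_of_transpose_mul_self _ _ (Real.sqrt_nonneg _)
        (transpose_mul_self_spectral_restrict hW1 hM (d k)) fun i => ?_
      rw [Real.sq_sqrt (by positivity)]
      by_cases hi : lev i = k
      · simp only [d, hi, if_true, one_mul, mul_one, abs_of_nonneg (hev i)]
        rw [← hi]; exact h1 i
      · simp only [d, hi, if_false, zero_mul, abs_zero]; positivity
    have a2 : ‖A k‖ ≤ Real.sqrt (F / 4 ^ k) := by
      refine (l2_opNorm_mul _ _).trans ?_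
      rw [l2_opNorm_transpose_real]
      exact (mul_le_of_le_one_right (norm_nonneg _)
        (l2_opNorm_le_one_of_transpose_mul_self hW1)).trans a1
    calc ‖A k‖ ^ 2 ≤ Real.sqrt (F / 4 ^ k) ^ 2 := by gcongr
      _ = _ := Real.sq_sqrt (by positivity)
  have hrank : ∀ k, (A k).rank ≤ (Finset.univ.filter fun i => lev i = k).card := by
    intro k
    calc (A k).rank ≤ (X * (W * diagonal (d k))).rank := rank_mul_le_left _ _
      _ ≤ (W * diagonal (d k)).rank := rank_mul_le_right _ _
      _ ≤ (diagonal (d k)).rank := rank_mul_le_right _ _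
      _ = _ := by
        rw [rank_diagonal, Fintype.card_subtype]
        congr 1
        ext i
        simp [d]
  refine ⟨A, ?_, ?_⟩
  · have e : ∑ k ∈ Finset.range (L + 1), diagonal (d k) = (1 : Matrix ι ι ℝ) := by
      ext i j
      rw [Matrix.sum_apply]
      by_cases hij : i = j
      · subst hij
        simp [d, Nat.lt_succ_of_le (hlev i)]
      · simp [hij]
    simp only [A]
    rw [← Finset.sum_mul, ← Finset.mul_sum, ← Finset.mul_sum, e, Matrix.mul_one, Matrix.mul_assoc,
      hW2, Matrix.mul_one]
  · have b1 : ∀ k < L, ((A k).rank : ℝ) * ‖A k‖ ^ 2 ≤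
        4 * ∑ i ∈ Finset.univ.filter (fun i => lev i = k), ev i := by
      intro k hk
      have c1 : ((A k).rank : ℝ) ≤ (Finset.univ.filter fun i => lev i = k).card := by
        exact_mod_cast hrank k
      calc ((A k).rank : ℝ) * ‖A k‖ ^ 2
          ≤ (Finset.univ.filter fun i => lev i = k).card * (F / 4 ^ k) := by
            gcongr; exact hnorm k
        _ = ∑ i ∈ Finset.univ.filter (fun i => lev i = k), F / 4 ^ k := by
            rw [Finset.sum_const, nsmul_eq_mul]
        _ ≤ ∑ i ∈ Finset.univ.filter (fun i => lev i = k), 4 * ev i := by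
            refine Finset.sum_le_sum fun i hi => ?_
            have hi' : lev i = k := (Finset.mem_filter.1 hi).2
            have := h2 i (by omega)
            rw [hi', pow_succ] at this
            have e : F / 4 ^ k = 4 * (F / (4 ^ k * 4)) := by field_simp
            linarith
        _ = _ := by rw [Finset.mul_sum]
    -- The last level has no lower bound on its singular values, so its rank is bounded trivially by
    -- `4^L`. It adds `F` to the `4F` of the other levels, whence the `5`.
    have b2 : ((A L).rank : ℝ) * ‖A L‖ ^ 2 ≤ F := by
      have c1 : ((A L).rank : ℝ) ≤ 4 ^ L := by
        exact_mod_cast (rank_le_card_width _).trans hL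
      calc ((A L).rank : ℝ) * ‖A L‖ ^ 2 ≤ 4 ^ L * (F / 4 ^ L) := by
            gcongr; exact hnorm L
        _ = F := by field_simp
    rw [Finset.sum_range_succ]
    have b3 : ∑ k ∈ Finset.range L, ∑ i ∈ Finset.univ.filter (fun i => lev i = k), ev i ≤ F := by
      refine le_of_le_of_eq (Finset.sum_le_sum_of_subset_of_nonneg
        (Finset.range_mono (Nat.le_succ L)) fun k _ _ => Finset.sum_nonneg fun i _ => hev i)
        (Finset.sum_fiberwise_of_maps_to (s := Finset.univ) (t := Finset.range (L + 1))
          (g := lev) (fun i _ => Finset.mem_range.2 (Nat.lt_succ_of_le (hlev i))) ev)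
    have b4 : ∑ k ∈ Finset.range L, ((A k).rank : ℝ) * ‖A k‖ ^ 2 ≤
        4 * ∑ k ∈ Finset.range L, ∑ i ∈ Finset.univ.filter (fun i => lev i = k), ev i := by
      rw [Finset.mul_sum]
      exact Finset.sum_le_sum fun k hk => b1 k (Finset.mem_range.1 hk)
    linarith

end

/-! ### From bounds by rank to a bound by Frobenius norms. -/

section

variable {ι : Type*} [Fintype ι] [DecidableEq ι]

/-- `|⟨g, (X ⊗ Y ⊗ Z) h⟩| ≤ B √(rst)` for contractions of ranks at most `r`, `s`, `t`, provided that
none of `r`, `s`, `t` exceeds the product of the other two. -/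
def BoundedOnTriangularRanks (g h : ι × ι × ι → ℝ) (B : ℝ) : Prop :=
  ∀ r ∈ Finset.Icc 1 (Fintype.card ι), ∀ s ∈ Finset.Icc 1 (Fintype.card ι),
    ∀ t ∈ Finset.Icc 1 (Fintype.card ι), r ≤ s * t → s ≤ r * t → t ≤ r * s →
    ∀ X Y Z : Matrix ι ι ℝ, X.rank ≤ r → Y.rank ≤ s → Z.rank ≤ t →
      ‖X‖ ≤ 1 → ‖Y‖ ≤ 1 → ‖Z‖ ≤ 1 → |trilinForm g h X Y Z| ≤ B * Real.sqrt (r * s * t)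

/-- The triangular conditions give `r², s², t² ≤ rst`, hence `(r + s + t)² ≤ 9rst`; together with `r
+ s + t ≤ 3N` both terms of the product are `O(N² rst)`. This is the only place where the triangular
conditions are needed. -/
theorem sqrt_mul_sqrt_le_of_triangular {N r s t : ℕ} (hr : r ≤ N) (hs : s ≤ N) (ht : t ≤ N)
    (h1 : r ≤ s * t) (h2 : s ≤ r * t) (h3 : t ≤ r * s) :
    Real.sqrt (8 * (r * s * t + N * (r + s + t) : ℕ)) *
      Real.sqrt (8 * (2 * (N * (r + s + t)) : ℕ)) ≤ 40 * N * Real.sqrt (r * s * t) := by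
  have a1 : (r : ℝ) ≤ s * t := by exact_mod_cast h1
  have a2 : (s : ℝ) ≤ r * t := by exact_mod_cast h2
  have a3 : (t : ℝ) ≤ r * s := by exact_mod_cast h3
  have b1 : (r : ℝ) ≤ N := by exact_mod_cast hr
  have b2 : (s : ℝ) ≤ N := by exact_mod_cast hs
  have b3 : (t : ℝ) ≤ N := by exact_mod_cast ht
  have r0 : (0 : ℝ) ≤ r := by positivity
  have s0 : (0 : ℝ) ≤ s := by positivity
  have t0 : (0 : ℝ) ≤ t := by positivity
  have N0 : (0 : ℝ) ≤ N := by positivity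
  rw [← Real.sqrt_mul (by positivity)]
  refine Real.sqrt_le_iff.2 ⟨by positivity, ?_⟩
  rw [mul_pow, Real.sq_sqrt (by positivity)]
  push_cast
  set p : ℝ := r * s * t with hp
  have p0 : 0 ≤ p := by positivity
  set S : ℝ := r + s + t with hS
  have S0 : 0 ≤ S := by positivity
  have c1 : S ^ 2 ≤ 9 * p := by
    have d1 := mul_le_mul_of_nonneg_left a1 r0
    have d2 := mul_le_mul_of_nonneg_left a2 s0
    have d3 := mul_le_mul_of_nonneg_left a3 t0
    nlinarith [sq_nonneg ((r : ℝ) - s), sq_nonneg ((s : ℝ) - t), sq_nonneg ((r : ℝ) - t)]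
  have c2 : S ≤ 3 * N := by linarith
  have c3 : S * p ≤ 3 * N * p := by gcongr
  have c4 : N * (S * p) ≤ N * (3 * N * p) := by gcongr
  have c5 : (N : ℝ) ^ 2 * S ^ 2 ≤ N ^ 2 * (9 * p) := by gcongr
  have c6 : 0 ≤ (N : ℝ) ^ 2 * p := by positivity
  nlinarith

/-- Each matrix is factored as `(X * Q) * Qᵀ` through its rank and fed to `exists_signs_form_le`.
The constant is `40960 = 64 · 16 · 40`. -/
theorem exists_boundedOnTriangularRanks (ι : Type*) [Fintype ι] [DecidableEq ι] :
    ∃ g h : ι × ι × ι → ℝ, (∀ p, g p = 1 ∨ g p = -1) ∧ (∀ p, h p = 1 ∨ h p = -1) ∧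
      BoundedOnTriangularRanks g h (40960 * Fintype.card ι) := by
  obtain ⟨h, hh, hb⟩ := exists_signs_contraction_le ι
  obtain ⟨g, hg, hgb⟩ := exists_signs_form_le ι h hb
  refine ⟨g, h, hg, hh, fun r hr s hs t ht h1 h2 h3 X Y Z rX rY rZ nX nY nZ => ?_⟩
  obtain ⟨Q, nQ, eQ⟩ := exists_mul_mul_transpose_eq_self X rX
  obtain ⟨Q', nQ', eQ'⟩ := exists_mul_mul_transpose_eq_self Y rY
  obtain ⟨Q'', nQ'', eQ''⟩ := exists_mul_mul_transpose_eq_self Z rZ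
  have hn : ∀ {q : ℕ} {X : Matrix ι ι ℝ} {Q : Matrix ι (Fin q) ℝ}, ‖X‖ ≤ 1 → ‖Q‖ ≤ 1 →
      ‖X * Q‖ ≤ 1 := fun h1 h2 => (l2_opNorm_mul _ _).trans (mul_le_one₀ h1 (norm_nonneg _) h2)
  have key := hgb r hr s hs t ht (X * Q) Q (Y * Q') Q' (Z * Q'') Q'' (hn nX nQ) nQ (hn nY nQ') nQ'
    (hn nZ nQ'') nQ''
  have e : X ⊗ₖ (Y ⊗ₖ Z) = ((X * Q) ⊗ₖ ((Y * Q') ⊗ₖ (Z * Q''))) * (Q ⊗ₖ (Q' ⊗ₖ Q''))ᵀ := by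
    rw [← kroneckerMap_transpose, ← kroneckerMap_transpose, ← mul_kronecker_mul,
      ← mul_kronecker_mul, Matrix.mul_assoc, Matrix.mul_assoc, Matrix.mul_assoc, eQ, eQ', eQ'']
  rw [trilinForm_eq_sum_mulVec, e]
  simp only [← mulVec_mulVec]
  refine key.trans ?_
  simp only [Finset.mem_Icc] at hr hs ht
  have := sqrt_mul_sqrt_le_of_triangular hr.2 hs.2 ht.2 h1 h2 h3
  nlinarith

theorem rank_trilinFormSlice_le (g h : ι × ι × ι → ℝ) {Y Z : Matrix ι ι ℝ} {s t : ℕ}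
    (hY : Y.rank ≤ s) (hZ : Z.rank ≤ t) : (trilinFormSlice g h Y Z).rank ≤ s * t := by
  obtain ⟨Q, -, eQ⟩ := exists_mul_mul_transpose_eq_self Y hY
  obtain ⟨Q', -, eQ'⟩ := exists_mul_mul_transpose_eq_self Z hZ
  have e : Y ⊗ₖ Z = ((Y * Q) ⊗ₖ (Z * Q')) * (Q ⊗ₖ Q')ᵀ := by
    rw [← kroneckerMap_transpose, ← mul_kronecker_mul, Matrix.mul_assoc, Matrix.mul_assoc, eQ, eQ']
  calc (trilinFormSlice g h Y Z).rank ≤ _ := rank_mul_le_left _ _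
    _ ≤ (Y ⊗ₖ Z).rank := rank_mul_le_right _ _
    _ ≤ ((Y * Q) ⊗ₖ (Z * Q')).rank := by rw [e]; exact rank_mul_le_left _ _
    _ ≤ s * t := (rank_le_card_width _).trans (by simp)

/-- `X` enters only through a trace pairing with `trilinFormSlice g h Y Z`, whose rank is at most `s
* t` because `Y ⊗ Z` factors through that dimension. Compressing `X` by the projection carrying this
slice changes nothing. -/
theorem exists_rank_le_trilinForm_eq (g h : ι × ι × ι → ℝ) {X Y Z : Matrix ι ι ℝ} {s t : ℕ}
    (hX : ‖X‖ ≤ 1) (hY : Y.rank ≤ s) (hZ : Z.rank ≤ t) :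
    ∃ X' : Matrix ι ι ℝ, ‖X'‖ ≤ 1 ∧ X'.rank ≤ s * t ∧
      trilinForm g h X' Y Z = trilinForm g h X Y Z := by
  obtain ⟨Q, nQ, eQ⟩ := exists_mul_mul_transpose_eq_self _ (rank_trilinFormSlice_le g h hY hZ)
  refine ⟨X * (Q * Qᵀ), ?_, ?_, ?_⟩
  · refine (l2_opNorm_mul _ _).trans (mul_le_one₀ hX (norm_nonneg _) ?_)
    refine (l2_opNorm_mul _ _).trans (mul_le_one₀ nQ (norm_nonneg _) ?_)
    rwa [l2_opNorm_transpose_real]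
  · rw [← Matrix.mul_assoc]
    exact (rank_mul_le_left _ _).trans ((rank_le_card_width _).trans (by simp))
  · rw [trilinForm_eq_trace, trilinForm_eq_trace, transpose_mul, transpose_mul,
      transpose_transpose, Matrix.mul_assoc, trace_mul_comm, Matrix.mul_assoc, eQ]

/-- If one rank exceeds the product of the other two, compression lowers it to exactly that product.
The new triple is triangular, and the bound only improves. -/
theorem BoundedOnTriangularRanks.abs_trilinForm_le_of_norm_le_one {g h : ι × ι × ι → ℝ} {B : ℝ}
    (H : BoundedOnTriangularRanks g h B) (hB : 0 ≤ B) {r s t : ℕ}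
    (hr : r ∈ Finset.Icc 1 (Fintype.card ι)) (hs : s ∈ Finset.Icc 1 (Fintype.card ι))
    (ht : t ∈ Finset.Icc 1 (Fintype.card ι)) {X Y Z : Matrix ι ι ℝ} (rX : X.rank ≤ r)
    (rY : Y.rank ≤ s) (rZ : Z.rank ≤ t) (nX : ‖X‖ ≤ 1) (nY : ‖Y‖ ≤ 1) (nZ : ‖Z‖ ≤ 1) :
    |trilinForm g h X Y Z| ≤ B * Real.sqrt (r * s * t) := by
  have hr' := Finset.mem_Icc.1 hr
  have hs' := Finset.mem_Icc.1 hs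
  have ht' := Finset.mem_Icc.1 ht
  have pos : ∀ {a b : ℕ}, 1 ≤ a → 1 ≤ b → 1 ≤ a * b := fun h1 h2 => Nat.mul_pos h1 h2
  have le1 : ∀ {a b : ℕ}, 1 ≤ b → a ≤ a * b := fun h1 => Nat.le_mul_of_pos_right _ h1
  have le2 : ∀ {a b : ℕ}, 1 ≤ b → a ≤ b * a := fun h1 => Nat.le_mul_of_pos_left _ h1
  by_cases c1 : r ≤ s * t
  · by_cases c2 : s ≤ r * t
    · by_cases c3 : t ≤ r * s
      · exact H r hr s hs t ht c1 c2 c3 X Y Z rX rY rZ nX nY nZ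
      · push Not at c3
        obtain ⟨Z', nZ', rZ', eZ'⟩ := exists_rank_le_trilinForm_eq
          (fun p => g (p.2.2, p.2.1, p.1)) (fun p => h (p.2.2, p.2.1, p.1)) nZ rY rX
        rw [trilinForm_swap_outer, trilinForm_swap_outer] at eZ'
        rw [mul_comm r s] at c3
        rw [← eZ']
        refine (H r hr s hs (s * r) (Finset.mem_Icc.2 ⟨pos hs'.1 hr'.1, c3.le.trans ht'.2⟩)
          ((le2 hs'.1).trans (le2 hs'.1)) ((le1 hr'.1).trans (le2 hr'.1)) (mul_comm s r).le
          X Y Z' rX rY rZ' nX nY nZ').trans ?_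
        have : ((s * r : ℕ) : ℝ) ≤ t := by exact_mod_cast c3.le
        gcongr
    · push Not at c2
      obtain ⟨Y', nY', rY', eY'⟩ := exists_rank_le_trilinForm_eq
        (fun p => g (p.2.1, p.1, p.2.2)) (fun p => h (p.2.1, p.1, p.2.2)) nY rX rZ
      rw [trilinForm_swap_left, trilinForm_swap_left] at eY'
      rw [← eY']
      refine (H r hr (r * t) (Finset.mem_Icc.2 ⟨pos hr'.1 ht'.1, c2.le.trans hs'.2⟩) t ht
        ((le1 ht'.1).trans (le1 ht'.1)) le_rfl ((le2 hr'.1).trans (le2 hr'.1))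
        X Y' Z rX rY' rZ nX nY' nZ).trans ?_
      have : ((r * t : ℕ) : ℝ) ≤ s := by exact_mod_cast c2.le
      gcongr
  · push Not at c1
    obtain ⟨X', nX', rX', eX'⟩ := exists_rank_le_trilinForm_eq g h nX rY rZ
    rw [← eX']
    refine (H (s * t) (Finset.mem_Icc.2 ⟨pos hs'.1 ht'.1, c1.le.trans hr'.2⟩) s hs t ht
      le_rfl ((le1 ht'.1).trans (le1 ht'.1)) ((le2 hs'.1).trans (le1 hs'.1))
      X' Y Z rX' rY rZ nX' nY nZ).trans ?_
    have : ((s * t : ℕ) : ℝ) ≤ r := by exact_mod_cast c1.le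
    gcongr

theorem BoundedOnTriangularRanks.abs_trilinForm_le {g h : ι × ι × ι → ℝ} {B : ℝ}
    (H : BoundedOnTriangularRanks g h B) (hB : 0 ≤ B) (X Y Z : Matrix ι ι ℝ) :
    |trilinForm g h X Y Z| ≤ B * ((Real.sqrt X.rank * ‖X‖) * (Real.sqrt Y.rank * ‖Y‖) *
      (Real.sqrt Z.rank * ‖Z‖)) := by
  have zero : ∀ {X Y Z : Matrix ι ι ℝ}, X = 0 ∨ Y = 0 ∨ Z = 0 → trilinForm g h X Y Z = 0 := by
    rintro X Y Z (rfl | rfl | rfl) <;> simp [trilinForm]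
  have nn : 0 ≤ B * ((Real.sqrt X.rank * ‖X‖) * (Real.sqrt Y.rank * ‖Y‖) *
      (Real.sqrt Z.rank * ‖Z‖)) := by positivity
  by_cases h0 : X = 0 ∨ Y = 0 ∨ Z = 0
  · rw [zero h0, abs_zero]; exact nn
  push Not at h0
  obtain ⟨hX, hY, hZ⟩ := h0
  have rk : ∀ {X : Matrix ι ι ℝ}, X ≠ 0 → X.rank ∈ Finset.Icc 1 (Fintype.card ι) := by
    intro X hX
    refine Finset.mem_Icc.2 ⟨Nat.one_le_iff_ne_zero.2 fun h => hX ?_, rank_le_card_width X⟩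
    obtain ⟨Q, -, e⟩ := exists_mul_mul_transpose_eq_self X h.le
    rw [← e]
    ext i j
    simp [mul_apply]
  have rs : ∀ {X : Matrix ι ι ℝ} (c : ℝ), (c • X).rank ≤ X.rank := by
    intro X c
    have : c • X = X * (c • (1 : Matrix ι ι ℝ)) := by simp
    rw [this]; exact rank_mul_le_left _ _
  have ns : ∀ {X : Matrix ι ι ℝ}, X ≠ 0 → ‖‖X‖⁻¹ • X‖ ≤ 1 := by
    intro X hX
    rw [norm_smul, norm_inv, norm_norm, inv_mul_cancel₀ (norm_ne_zero_iff.2 hX)]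
  have key := H.abs_trilinForm_le_of_norm_le_one hB (rk hX) (rk hY) (rk hZ) (rs ‖X‖⁻¹) (rs ‖Y‖⁻¹)
    (rs ‖Z‖⁻¹) (ns hX) (ns hY) (ns hZ)
  rw [trilinForm_smul_smul_smul, abs_mul, abs_of_nonneg (by positivity),
    Real.sqrt_mul (by positivity), Real.sqrt_mul (by positivity)] at key
  have pX := norm_pos_iff.2 hX
  have pY := norm_pos_iff.2 hY
  have pZ := norm_pos_iff.2 hZ
  calc |trilinForm g h X Y Z| = (‖X‖ * ‖Y‖ * ‖Z‖) *
        (‖X‖⁻¹ * ‖Y‖⁻¹ * ‖Z‖⁻¹ * |trilinForm g h X Y Z|) := by field_simp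
    _ ≤ (‖X‖ * ‖Y‖ * ‖Z‖) * (B * (Real.sqrt X.rank * Real.sqrt Y.rank * Real.sqrt Z.rank)) := by
        gcongr
    _ = _ := by ring

/-- The Frobenius norm. -/
noncomputable def frobNorm {𝕜 ι : Type*} [Norm 𝕜] [Fintype ι] (X : Matrix ι ι 𝕜) : ℝ :=
  Real.sqrt (∑ i, ∑ j, ‖X i j‖ ^ 2)

/-- Expand into nearly flat pieces. Cauchy–Schwarz over the `L + 1` pieces of each argument costs
`√(5(L + 1))`; the three arguments together are the source of `(log n)^{3/2}`. -/
theorem BoundedOnTriangularRanks.abs_trilinForm_le_frobNorm {g h : ι × ι × ι → ℝ} {B : ℝ}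
    (H : BoundedOnTriangularRanks g h B) (hB : 0 ≤ B) {L : ℕ} (hL : Fintype.card ι ≤ 4 ^ L)
    (X Y Z : Matrix ι ι ℝ) :
    |trilinForm g h X Y Z| ≤
      B * Real.sqrt (5 * (L + 1)) ^ 3 * (frobNorm X * frobNorm Y * frobNorm Z) := by
  have dec : ∀ X : Matrix ι ι ℝ, ∃ A : ℕ → Matrix ι ι ℝ, X = ∑ k ∈ Finset.range (L + 1), A k ∧
      ∑ k ∈ Finset.range (L + 1), Real.sqrt (A k).rank * ‖A k‖ ≤
        Real.sqrt (5 * (L + 1)) * frobNorm X := by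
    intro X
    obtain ⟨A, h1, h2⟩ := exists_sum_eq_rank_mul_norm_sq_le X L hL
    refine ⟨A, h1, ?_⟩
    rw [frobNorm, ← Real.sqrt_mul (by positivity)]
    refine Real.le_sqrt_of_sq_le ?_
    refine sq_sum_le_card_mul_sum_sq.trans ?_
    simp only [Finset.card_range, mul_pow, Real.norm_eq_abs, sq_abs]
    have : ∀ k, Real.sqrt (A k).rank ^ 2 = (A k).rank := fun k => Real.sq_sqrt (by positivity)
    simp only [this]
    push_cast
    nlinarith [show (0 : ℝ) ≤ L from by positivity]
  obtain ⟨A, eA, hA⟩ := dec X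
  obtain ⟨A', eA', hA'⟩ := dec Y
  obtain ⟨A'', eA'', hA''⟩ := dec Z
  have e : trilinForm g h X Y Z = ∑ k ∈ Finset.range (L + 1), ∑ l ∈ Finset.range (L + 1),
      ∑ m ∈ Finset.range (L + 1), trilinForm g h (A k) (A' l) (A'' m) := by
    conv_lhs => rw [eA, eA', eA'', trilinForm_sum_sum_sum]
  rw [e]
  calc |∑ k ∈ Finset.range (L + 1), ∑ l ∈ Finset.range (L + 1),
      ∑ m ∈ Finset.range (L + 1), trilinForm g h (A k) (A' l) (A'' m)|
      ≤ ∑ k ∈ Finset.range (L + 1), ∑ l ∈ Finset.range (L + 1),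
        ∑ m ∈ Finset.range (L + 1), |trilinForm g h (A k) (A' l) (A'' m)| :=
        (Finset.abs_sum_le_sum_abs _ _).trans (Finset.sum_le_sum fun k _ =>
          (Finset.abs_sum_le_sum_abs _ _).trans (Finset.sum_le_sum fun l _ =>
            Finset.abs_sum_le_sum_abs _ _))
    _ ≤ ∑ k ∈ Finset.range (L + 1), ∑ l ∈ Finset.range (L + 1),
        ∑ m ∈ Finset.range (L + 1), B * ((Real.sqrt (A k).rank * ‖A k‖) *
          (Real.sqrt (A' l).rank * ‖A' l‖) * (Real.sqrt (A'' m).rank * ‖A'' m‖)) :=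
        Finset.sum_le_sum fun k _ => Finset.sum_le_sum fun l _ => Finset.sum_le_sum fun m _ =>
          H.abs_trilinForm_le hB _ _ _
    _ = B * ((∑ k ∈ Finset.range (L + 1), Real.sqrt (A k).rank * ‖A k‖) *
        (∑ k ∈ Finset.range (L + 1), Real.sqrt (A' k).rank * ‖A' k‖) *
        (∑ k ∈ Finset.range (L + 1), Real.sqrt (A'' k).rank * ‖A'' k‖)) := by
        simp only [← Finset.mul_sum]
        rw [Finset.sum_mul_sum, Finset.sum_mul]
        simp only [← Finset.sum_mul]
    _ ≤ B * ((Real.sqrt (5 * (L + 1)) * frobNorm X) * (Real.sqrt (5 * (L + 1)) * frobNorm Y) *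
        (Real.sqrt (5 * (L + 1)) * frobNorm Z)) := by
        have p0 : ∀ X : Matrix ι ι ℝ, 0 ≤ Real.sqrt (5 * (L + 1)) * frobNorm X := fun X =>
          mul_nonneg (Real.sqrt_nonneg _) (Real.sqrt_nonneg _)
        have := mul_nonneg (p0 X) (p0 Y)
        have := p0 X
        gcongr
    _ = _ := by ring

end

end RandomForms

open Matrix
open scoped ComplexConjugate

/-! ### Passage from real to complex matrices. -/

section Complexification

variable {ι : Type*} [Fintype ι]

theorem trilinForm_add_left {R : Type*} [CommSemiring R] (g h : ι × ι × ι → R)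
    (X X' Y Z : Matrix ι ι R) :
    trilinForm g h (X + X') Y Z = trilinForm g h X Y Z + trilinForm g h X' Y Z := by
  simp only [trilinForm, Matrix.add_apply, add_mul, mul_add, Finset.sum_add_distrib]

theorem trilinForm_map_ofReal (g h : ι × ι × ι → ℝ) (X Y Z : Matrix ι ι ℝ) :
    trilinForm (fun p => (g p : ℂ)) (fun p => (h p : ℂ)) (X.map Complex.ofReal) (Y.map Complex.ofReal) (Z.map Complex.ofReal) =
      Complex.ofReal (trilinForm g h X Y Z) := by
  simp [trilinForm]

theorem frobNorm_map_re_le (X : Matrix ι ι ℂ) : frobNorm (X.map Complex.re) ≤ frobNorm X := by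
  refine Real.sqrt_le_sqrt (Finset.sum_le_sum fun i _ => Finset.sum_le_sum fun j _ => ?_)
  exact pow_le_pow_left₀ (norm_nonneg _) (Complex.abs_re_le_norm _) 2

theorem frobNorm_map_im_le (X : Matrix ι ι ℂ) : frobNorm (X.map Complex.im) ≤ frobNorm X := by
  refine Real.sqrt_le_sqrt (Finset.sum_le_sum fun i _ => Finset.sum_le_sum fun j _ => ?_)
  exact pow_le_pow_left₀ (norm_nonneg _) (Complex.abs_im_le_norm _) 2

/-- Real and imaginary parts are estimated separately, at the cost of a factor `2` in one argument.
Three uses give the `8` in `norm_trilinForm_ofReal_le`. -/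
theorem norm_trilinForm_le_of_forall_real {g h : ι × ι × ι → ℂ} {Y Z : Matrix ι ι ℂ} {c : ℝ}
    (hc : 0 ≤ c) (H : ∀ X : Matrix ι ι ℝ, ‖trilinForm g h (X.map Complex.ofReal) Y Z‖ ≤ c * frobNorm X)
    (X : Matrix ι ι ℂ) : ‖trilinForm g h X Y Z‖ ≤ 2 * c * frobNorm X := by
  have e : X = (X.map Complex.re).map Complex.ofReal + Complex.I • (X.map Complex.im).map Complex.ofReal := by
    ext i j
    simp only [Matrix.add_apply, Matrix.smul_apply, Matrix.map_apply, smul_eq_mul]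
    rw [mul_comm]; exact (Complex.re_add_im _).symm
  have h1 := H (X.map Complex.re)
  have h2 := H (X.map Complex.im)
  have h3 := mul_le_mul_of_nonneg_left (frobNorm_map_re_le X) hc
  have h4 := mul_le_mul_of_nonneg_left (frobNorm_map_im_le X) hc
  conv_lhs => rw [e]
  rw [trilinForm_add_left, trilinForm_smul_left]
  refine (norm_add_le _ _).trans ?_
  rw [norm_mul, Complex.norm_I, one_mul]
  linarith

theorem norm_trilinForm_ofReal_le {g h : ι × ι × ι → ℝ} {c : ℝ} (hc : 0 ≤ c)
    (H : ∀ X Y Z, |trilinForm g h X Y Z| ≤ c * (frobNorm X * frobNorm Y * frobNorm Z))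
    (X Y Z : Matrix ι ι ℂ) :
    ‖trilinForm (fun p => (g p : ℂ)) (fun p => (h p : ℂ)) X Y Z‖ ≤
      8 * c * (frobNorm X * frobNorm Y * frobNorm Z) := by
  have nn : ∀ {𝕜 : Type} [NormedField 𝕜] (X : Matrix ι ι 𝕜), 0 ≤ frobNorm X :=
    fun X => Real.sqrt_nonneg _
  have h1 : ∀ (X : Matrix ι ι ℂ) (Y Z : Matrix ι ι ℝ),
      ‖trilinForm (fun p => (g p : ℂ)) (fun p => (h p : ℂ)) X (Y.map Complex.ofReal) (Z.map Complex.ofReal)‖ ≤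
        2 * (c * frobNorm Y * frobNorm Z) * frobNorm X := by
    intro X Y Z
    refine norm_trilinForm_le_of_forall_real
      (mul_nonneg (mul_nonneg hc (nn _)) (nn _)) (fun X => ?_) X
    rw [trilinForm_map_ofReal, Complex.norm_real, Real.norm_eq_abs]
    exact (H X Y Z).trans (le_of_eq (by ring))
  have h2 : ∀ (X Y : Matrix ι ι ℂ) (Z : Matrix ι ι ℝ),
      ‖trilinForm (fun p => (g p : ℂ)) (fun p => (h p : ℂ)) X Y (Z.map Complex.ofReal)‖ ≤
        2 * (2 * c * frobNorm X * frobNorm Z) * frobNorm Y := by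
    intro X Y Z
    rw [← trilinForm_swap_left]
    refine norm_trilinForm_le_of_forall_real
      (mul_nonneg (mul_nonneg (by positivity) (nn _)) (nn _)) (fun Y => ?_) Y
    rw [trilinForm_swap_left (fun p => (g p : ℂ)) (fun p => (h p : ℂ))]
    exact (h1 X Y Z).trans (le_of_eq (by ring))
  rw [← trilinForm_swap_outer]
  refine (norm_trilinForm_le_of_forall_real (c := 4 * c * frobNorm X * frobNorm Y)
    (mul_nonneg (mul_nonneg (by positivity) (nn _)) (nn _)) (fun Z => ?_) Z).trans
    (le_of_eq (by ring))
  rw [trilinForm_swap_outer (fun p => (g p : ℂ)) (fun p => (h p : ℂ))]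
  exact (h2 X Y Z).trans (le_of_eq (by ring))

theorem trilinForm_eq_nested (g h : ι × ι × ι → ℂ) (X Y Z : Matrix ι ι ℂ) :
    trilinForm g h X Y Z = ∑ i, ∑ i', X i i' * ∑ j, ∑ j', Y j j' * ∑ k, ∑ k', Z k k' *
      (g (i, j, k) * h (i', j', k')) := by
  have e : trilinForm g h X Y Z = ∑ i, ∑ j, ∑ k, ∑ i', ∑ j', ∑ k',
      X i i' * (Y j j' * (Z k k' * (g (i, j, k) * h (i', j', k')))) := by
    simp only [trilinForm, Fintype.sum_prod_type]
    refine Finset.sum_congr rfl fun i _ => Finset.sum_congr rfl fun j _ =>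
      Finset.sum_congr rfl fun k _ => Finset.sum_congr rfl fun i' _ =>
      Finset.sum_congr rfl fun j' _ => Finset.sum_congr rfl fun k' _ => by ring
  rw [e]
  simp only [Finset.mul_sum]
  refine Finset.sum_congr rfl fun i _ => ?_
  calc _ = ∑ j, ∑ i', ∑ k, ∑ j', ∑ k', X i i' * (Y j j' * (Z k k' * (g (i, j, k) *
        h (i', j', k')))) := Finset.sum_congr rfl fun j _ => Finset.sum_comm
    _ = ∑ i', ∑ j, ∑ k, ∑ j', ∑ k', X i i' * (Y j j' * (Z k k' * (g (i, j, k) *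
        h (i', j', k')))) := Finset.sum_comm
    _ = _ := Finset.sum_congr rfl fun i' _ => Finset.sum_congr rfl fun j _ => Finset.sum_comm

end Complexification

/-! ### Parseval identities, Pauli matrices and the lower bound for the operator norm. -/

theorem sum_norm_sq_eq_of_orthogonal {κ ι : Type*} [Fintype κ] [Fintype ι] [DecidableEq ι]
    (V : κ → ι → ℂ) (N : ℝ)
    (hV : ∀ i j, ∑ k, V k i * conj (V k j) = if i = j then (N : ℂ) else 0) (f : ι → ℂ) :
    ∑ k, ‖∑ i, V k i * f i‖ ^ 2 = N * ∑ i, ‖f i‖ ^ 2 := by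
  have e : ∀ z : ℂ, ((‖z‖ ^ 2 : ℝ) : ℂ) = z * conj z := by
    intro z; rw [Complex.mul_conj, Complex.normSq_eq_norm_sq]
  apply Complex.ofReal_injective
  rw [Complex.ofReal_sum, Complex.ofReal_mul, Complex.ofReal_sum]
  simp only [e, map_sum, map_mul, Finset.sum_mul_sum]
  calc ∑ k, ∑ i, ∑ j, V k i * f i * (conj (V k j) * conj (f j))
      = ∑ i, ∑ j, ∑ k, V k i * f i * (conj (V k j) * conj (f j)) := by
        rw [Finset.sum_comm]
        exact Finset.sum_congr rfl fun i _ => Finset.sum_comm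
    _ = ∑ i, ∑ j, (∑ k, V k i * conj (V k j)) * (f i * conj (f j)) := by
        refine Finset.sum_congr rfl fun i _ => Finset.sum_congr rfl fun j _ => ?_
        rw [Finset.sum_mul]
        exact Finset.sum_congr rfl fun k _ => by ring
    _ = _ := by simp [hV, Finset.mul_sum]

/-- The vector of `ℂ^G ⊗₂ ℂ^G ⊗₂ ℂ^G` with the given coordinates. -/
noncomputable def tensorVector {G : Type u} [Fintype G] [DecidableEq G]
    (g : G × G × G → ℂ) : HilbertTensor3 (EuclideanSpace ℂ G) :=
  ∑ p, g p • HilbertTensor.tmul (EuclideanSpace.single p.1 (1 : ℂ))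
    (HilbertTensor.tmul (EuclideanSpace.single p.2.1 (1 : ℂ))
      (EuclideanSpace.single p.2.2 (1 : ℂ)))

theorem norm_tensorVector {G : Type u} [Fintype G] [DecidableEq G] (g : G × G × G → ℂ)
    (hg : ∀ p, ‖g p‖ = 1) :
    ‖tensorVector g‖ ^ 2 = (Fintype.card G : ℝ) ^ 3 := by
  have h : (inner ℂ (tensorVector g) (tensorVector g) : ℂ) = (Fintype.card G : ℂ) ^ 3 := by
    simp only [tensorVector, sum_inner, inner_sum, inner_smul_left, inner_smul_right,
      HilbertTensor.inner_tmul]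
    have : ∀ p q : G × G × G,
        (inner ℂ (EuclideanSpace.single q.1 (1 : ℂ)) (EuclideanSpace.single p.1 (1 : ℂ)) : ℂ) *
        (inner ℂ (EuclideanSpace.single q.2.1 (1 : ℂ)) (EuclideanSpace.single p.2.1 (1 : ℂ)) *
        inner ℂ (EuclideanSpace.single q.2.2 (1 : ℂ)) (EuclideanSpace.single p.2.2 (1 : ℂ))) =
        if p = q then 1 else 0 := by
      rintro ⟨i, j, k⟩ ⟨i', j', k'⟩
      simp only [EuclideanSpace.inner_single_left, map_one, PiLp.single_apply,
        Prod.mk.injEq, ← ite_and, mul_ite, mul_one, mul_zero]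
      grind
    simp only [this]
    simp [Complex.mul_conj, Complex.normSq_eq_norm_sq, hg, pow_succ, mul_assoc]
  rw [inner_self_eq_norm_sq_to_K] at h
  apply Complex.ofReal_injective
  push_cast
  exact h

section Pauli

variable {G : Type u} [AddCommGroup G] [Fintype G]

theorem sum_apply_mul_conj (χ ψ : AddChar G ℂ) [Decidable (χ = ψ)] :
    ∑ i, χ i * conj (ψ i) = if χ = ψ then (Fintype.card G : ℂ) else 0 := by
  classical
  have : ∀ i, χ i * conj (ψ i) = (χ - ψ) i := by
    intro i
    rw [← AddChar.map_neg_eq_conj, AddChar.sub_apply, AddChar.map_neg_eq_inv]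
  simp only [this, AddChar.sum_eq_ite, sub_eq_zero]

variable [DecidableEq G]

/-- The generalized Pauli matrices of a finite abelian group, indexed by characters and
translations. -/
def pauli (a : AddChar G ℂ × G) : Matrix G G ℂ :=
  of fun i i' => if i' = i + a.2 then a.1 i else 0

theorem sum_addChar_mul_conj (i j : G) :
    ∑ χ : AddChar G ℂ, χ i * conj (χ j) = if i = j then (Fintype.card G : ℂ) else 0 := by
  have : ∀ χ : AddChar G ℂ, χ i * conj (χ j) = χ (i - j) := by
    intro χ
    rw [← AddChar.map_neg_eq_conj, ← AddChar.map_add_eq_mul, sub_eq_add_neg]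
  simp only [this, AddChar.sum_apply_eq_ite, sub_eq_zero]

theorem sum_pauli_mul_conj (p q : G × G) :
    ∑ a, pauli a p.1 p.2 * conj (pauli a q.1 q.2) =
      if p = q then ((Fintype.card G : ℝ) : ℂ) else 0 := by
  obtain ⟨i, i'⟩ := p
  obtain ⟨j, j'⟩ := q
  simp only [pauli, of_apply, Fintype.sum_prod_type_right, Prod.mk.injEq, Complex.ofReal_natCast]
  have : ∀ b : G, ∑ χ : AddChar G ℂ, (if i' = i + b then χ i else 0) *
      conj (if j' = j + b then χ j else 0) =
      if b = i' - i then (if i = j ∧ i' = j' then (Fintype.card G : ℂ) else 0) else 0 := by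
    intro b
    by_cases hb : b = i' - i
    · subst hb
      by_cases hij : i = j
      · subst hij
        have := sum_addChar_mul_conj i i
        by_cases h2 : i' = j'
        · subst h2; simpa using this
        · simp [h2, Ne.symm h2]
      · by_cases h2 : j' = j + (i' - i)
        · simpa [hij, h2] using sum_addChar_mul_conj i j
        · simp [hij, h2]
    · have : i' ≠ i + b := by rintro rfl; simp at hb
      simp [hb, this]
  simp only [this]
  simp

theorem sum_norm_sq_pauli (m : G → G → ℂ) :
    ∑ a, ‖∑ i, ∑ i', pauli a i i' * m i i'‖ ^ 2 = Fintype.card G * ∑ i, ∑ i', ‖m i i'‖ ^ 2 := by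
  have := sum_norm_sq_eq_of_orthogonal (fun a (p : G × G) => pauli a p.1 p.2) (Fintype.card G)
    sum_pauli_mul_conj (fun p => m p.1 p.2)
  simpa only [Fintype.sum_prod_type (α₁ := G) (α₂ := G)] using this

/-- Different translations have disjoint supports, and for each translation Parseval over the
characters gives `N · N`. The squared norm is therefore `N³`. -/
theorem frobNorm_sum_smul_pauli (x : AddChar G ℂ × G → ℂ) (hx : ∀ a, ‖x a‖ = 1) :
    frobNorm (∑ a, x a • pauli a) = Fintype.card G * Real.sqrt (Fintype.card G) := by
  classical
  have e : ∑ i, ∑ i', ‖(∑ a, x a • pauli a) i i'‖ ^ 2 = (Fintype.card G : ℝ) ^ 3 := by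
    have e1 : ∀ i b, (∑ a, x a • pauli a) i (i + b) = ∑ χ : AddChar G ℂ, χ i * x (χ, b) := by
      intro i b
      simp only [Matrix.sum_apply, Matrix.smul_apply, smul_eq_mul, pauli, of_apply,
        Fintype.sum_prod_type, add_right_inj]
      refine Finset.sum_congr rfl fun χ _ => ?_
      simp [mul_comm]
    have e2 : ∀ i, ∑ i', ‖(∑ a, x a • pauli a) i i'‖ ^ 2 =
        ∑ b, ‖∑ χ : AddChar G ℂ, χ i * x (χ, b)‖ ^ 2 := by
      intro i
      rw [← Equiv.sum_comp (Equiv.addLeft i)]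
      exact Finset.sum_congr rfl fun b _ => by rw [Equiv.coe_addLeft, e1]
    simp only [e2]
    rw [Finset.sum_comm]
    have e3 : ∀ b, ∑ i : G, ‖∑ χ : AddChar G ℂ, χ i * x (χ, b)‖ ^ 2 =
        Fintype.card G * ∑ χ : AddChar G ℂ, ‖x (χ, b)‖ ^ 2 := fun b =>
      sum_norm_sq_eq_of_orthogonal (fun (i : G) (χ : AddChar G ℂ) => χ i) (Fintype.card G)
        (fun χ ψ => by rw [sum_apply_mul_conj]; simp) _
    simp only [e3, hx]
    simp [AddChar.card_eq]
    ring
  rw [frobNorm, e, show (Fintype.card G : ℝ) ^ 3 = (Fintype.card G) ^ 2 * Fintype.card G by ring,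
    Real.sqrt_mul (by positivity), Real.sqrt_sq (by positivity)]

/-- Parseval in each of the three matrix arguments contributes a factor `N`, leaving the `N⁶`
unimodular entries of `g ⊗ h`. -/
theorem sum_norm_sq_trilinForm_pauli (g h : G × G × G → ℂ) (hg : ∀ p, ‖g p‖ = 1)
    (hh : ∀ p, ‖h p‖ = 1) :
    ∑ a, ∑ b, ∑ c, ‖trilinForm g h (pauli a) (pauli b) (pauli c)‖ ^ 2 =
      (Fintype.card G : ℝ) ^ 9 := by
  simp only [trilinForm_eq_nested]
  have e1 : ∀ b c : AddChar G ℂ × G, ∑ a : AddChar G ℂ × G,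
      ‖∑ i, ∑ i', pauli a i i' * ∑ j, ∑ j', pauli b j j' * ∑ k, ∑ k', pauli c k k' *
        (g (i, j, k) * h (i', j', k'))‖ ^ 2 = Fintype.card G * ∑ i, ∑ i',
      ‖∑ j, ∑ j', pauli b j j' * ∑ k, ∑ k', pauli c k k' *
        (g (i, j, k) * h (i', j', k'))‖ ^ 2 := fun b c => sum_norm_sq_pauli _
  have e2 : ∀ (c : AddChar G ℂ × G) i i', ∑ b : AddChar G ℂ × G,
      ‖∑ j, ∑ j', pauli b j j' * ∑ k, ∑ k', pauli c k k' *
        (g (i, j, k) * h (i', j', k'))‖ ^ 2 = Fintype.card G * ∑ j, ∑ j',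
      ‖∑ k, ∑ k', pauli c k k' * (g (i, j, k) * h (i', j', k'))‖ ^ 2 :=
    fun c i i' => sum_norm_sq_pauli _
  have e3 : ∀ i i' j j', ∑ c : AddChar G ℂ × G,
      ‖∑ k, ∑ k', pauli c k k' * (g (i, j, k) * h (i', j', k'))‖ ^ 2 = Fintype.card G * ∑ k, ∑ k',
      ‖g (i, j, k) * h (i', j', k')‖ ^ 2 :=
    fun i i' j j' => sum_norm_sq_pauli _
  calc _ = ∑ c : AddChar G ℂ × G, ∑ b : AddChar G ℂ × G, ∑ a : AddChar G ℂ × G,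
      ‖∑ i, ∑ i', pauli a i i' * ∑ j, ∑ j', pauli b j j' * ∑ k, ∑ k', pauli c k k' *
        (g (i, j, k) * h (i', j', k'))‖ ^ 2 := by
        rw [Finset.sum_comm]
        rw [Finset.sum_congr rfl fun b _ => Finset.sum_comm]
        exact Finset.sum_comm
    _ = ∑ c : AddChar G ℂ × G, Fintype.card G * ∑ i, ∑ i', ∑ b : AddChar G ℂ × G,
      ‖∑ j, ∑ j', pauli b j j' * ∑ k, ∑ k', pauli c k k' *
        (g (i, j, k) * h (i', j', k'))‖ ^ 2 := by
        simp only [e1]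
        refine Finset.sum_congr rfl fun c _ => ?_
        rw [← Finset.mul_sum, Finset.sum_comm]
        congr 1
        exact Finset.sum_congr rfl fun i _ => Finset.sum_comm
    _ = Fintype.card G * ∑ i, ∑ i', Fintype.card G * ∑ j, ∑ j', ∑ c : AddChar G ℂ × G,
        ‖∑ k, ∑ k', pauli c k k' * (g (i, j, k) * h (i', j', k'))‖ ^ 2 := by
        simp only [e2]
        rw [← Finset.mul_sum, Finset.sum_comm]
        congr 1
        refine Finset.sum_congr rfl fun i _ => ?_
        rw [Finset.sum_comm]
        refine Finset.sum_congr rfl fun i' _ => ?_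
        rw [← Finset.mul_sum, Finset.sum_comm]
        congr 1
        exact Finset.sum_congr rfl fun j _ => Finset.sum_comm
    _ = _ := by
        simp only [e3, norm_mul, hg, hh]
        simp
        ring

/-- The unitary operator on `ℂ^G` whose matrix is the entrywise conjugate of `pauli a`. -/
noncomputable def pauliConj (a : AddChar G ℂ × G) : EuclideanSpace ℂ G ≃ₗᵢ[ℂ] EuclideanSpace ℂ G where
  toFun v := WithLp.toLp 2 fun i => conj (a.1 i) * v (i + a.2)
  invFun v := WithLp.toLp 2 fun i => a.1 (i - a.2) * v (i - a.2)
  map_add' v w := by ext i; simp [mul_add]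
  map_smul' c v := by ext i; simp; ring
  left_inv v := by
    ext i
    simp [← mul_assoc, Complex.mul_conj, Complex.normSq_eq_norm_sq]
  right_inv v := by
    ext i
    simp [← mul_assoc, ← Complex.normSq_eq_conj_mul_self, Complex.normSq_eq_norm_sq]
  norm_map' v := by
    simp only [EuclideanSpace.norm_eq, LinearEquiv.coe_mk, LinearMap.coe_mk, AddHom.coe_mk,
      norm_mul, RCLike.norm_conj, AddChar.norm_apply, one_mul]
    congr 1
    exact Equiv.sum_comp (Equiv.addRight a.2) (fun i => ‖v i‖ ^ 2)

theorem inner_single_pauliConj_single (a : AddChar G ℂ × G) (i i' : G) :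
    inner ℂ (EuclideanSpace.single i (1 : ℂ)) (pauliConj a (EuclideanSpace.single i' (1 : ℂ))) =
      conj (pauli a i i') := by
  rw [EuclideanSpace.inner_single_left]
  simp [pauliConj, pauli, eq_comm, apply_ite (starRingEnd ℂ)]

/-- Conjugating the Pauli matrices makes this matrix coefficient the conjugate of the tensor
coefficient, so the weighted sum becomes a sum of `|t_{abc}|²` without cancellation. -/
theorem inner_tensorVector_tensorUnitary (g h : G × G × G → ℝ) (a b c : AddChar G ℂ × G) :
    inner ℂ (tensorVector fun p => (g p : ℂ))
      (tensorUnitary (pauliConj a) (pauliConj b) (pauliConj c) (tensorVector fun p => (h p : ℂ))) =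
    conj (trilinForm (fun p => (g p : ℂ)) (fun p => (h p : ℂ)) (pauli a) (pauli b) (pauli c)) := by
  have e : ∀ x y z : EuclideanSpace ℂ G,
      tensorUnitary (pauliConj a) (pauliConj b) (pauliConj c)
        (HilbertTensor.tmul x (HilbertTensor.tmul y z)) =
      HilbertTensor.tmul (pauliConj a x) (HilbertTensor.tmul (pauliConj b y) (pauliConj c z)) := by
    intro x y z
    refine (HilbertTensor.map_tmul _ _ _ _).trans ?_
    rw [HilbertTensor.map_tmul]; rfl
  simp only [tensorVector, map_sum, map_smul, e, sum_inner, inner_sum, inner_smul_left,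
    inner_smul_right, HilbertTensor.inner_tmul, inner_single_pauliConj_single, trilinForm, map_mul,
    Complex.conj_ofReal]
  rw [Finset.sum_comm]
  exact Finset.sum_congr rfl fun p _ => (Finset.mul_sum _ _ _).trans
    (Finset.sum_congr rfl fun q _ => by ring)

theorem card_pow_six_le_norm_sum_smul_tensorUnitary [Nonempty G] (g h : G × G × G → ℝ)
    (hg : ∀ p, g p = 1 ∨ g p = -1) (hh : ∀ p, h p = 1 ∨ h p = -1) :
    (Fintype.card G : ℝ) ^ 6 ≤ ‖∑ a, ∑ b, ∑ c,
      trilinForm (fun p => (g p : ℂ)) (fun p => (h p : ℂ)) (pauli a) (pauli b) (pauli c) •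
        tensorUnitary (pauliConj a) (pauliConj b) (pauliConj c)‖ := by
  have hn : ∀ {g : G × G × G → ℝ}, (∀ p, g p = 1 ∨ g p = -1) → ∀ p, ‖(g p : ℂ)‖ = 1 := by
    intro g hg p
    rcases hg p with h | h <;> simp [h]
  set t := fun a b c : AddChar G ℂ × G =>
    trilinForm (fun p => (g p : ℂ)) (fun p => (h p : ℂ)) (pauli a) (pauli b) (pauli c)
  set O : HilbertTensor3 (EuclideanSpace ℂ G) →L[ℂ] HilbertTensor3 (EuclideanSpace ℂ G) :=
    ∑ a, ∑ b, ∑ c, t a b c • tensorUnitary (pauliConj a) (pauliConj b) (pauliConj c)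
  set ξ := tensorVector fun p => (g p : ℂ)
  set η := tensorVector fun p => (h p : ℂ)
  have h1 : inner ℂ ξ (O η) = (((Fintype.card G : ℝ) ^ 9 : ℝ) : ℂ) := by
    rw [← sum_norm_sq_trilinForm_pauli _ _ (hn hg) (hn hh)]
    simp only [O, _root_.sum_apply, _root_.smul_apply, inner_sum,
      inner_smul_right, ξ, η, inner_tensorVector_tensorUnitary, Complex.ofReal_sum]
    refine Finset.sum_congr rfl fun a _ => Finset.sum_congr rfl fun b _ =>
      Finset.sum_congr rfl fun c _ => ?_
    rw [Complex.mul_conj, Complex.normSq_eq_norm_sq]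
  have h2 : (Fintype.card G : ℝ) ^ 9 ≤ ‖ξ‖ * (‖O‖ * ‖η‖) := by
    calc (Fintype.card G : ℝ) ^ 9 = ‖(inner ℂ ξ (O η) : ℂ)‖ := by
          rw [h1, Complex.norm_real, Real.norm_of_nonneg (by positivity)]
      _ ≤ ‖ξ‖ * ‖O η‖ := norm_inner_le_norm _ _
      _ ≤ _ := by gcongr; exact O.le_opNorm η
  have hξ : ‖ξ‖ ^ 2 = (Fintype.card G : ℝ) ^ 3 := norm_tensorVector _ (hn hg)
  have hη : ‖η‖ ^ 2 = (Fintype.card G : ℝ) ^ 3 := norm_tensorVector _ (hn hh)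
  have h3 : ‖ξ‖ * ‖η‖ = (Fintype.card G : ℝ) ^ 3 := by
    have : ‖ξ‖ = ‖η‖ := by
      rw [← sq_eq_sq₀ (norm_nonneg _) (norm_nonneg _), hξ, hη]
    rw [← this, ← sq, hξ] at *
  have h4 : (0 : ℝ) < (Fintype.card G : ℝ) ^ 3 := by
    have : 0 < Fintype.card G := Fintype.card_pos
    positivity
  have h5 : ‖ξ‖ * (‖O‖ * ‖η‖) = ‖O‖ * (Fintype.card G : ℝ) ^ 3 := by rw [← h3]; ring
  rw [h5] at h2
  refine le_of_mul_le_mul_right (le_of_eq_of_le (by ring) h2) h4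

end Pauli

/-! ### Unitaries on a one-dimensional space are unimodular scalars. -/

section OneDimensional

namespace HilbertTensor

variable {E F : Type u} [NormedAddCommGroup E] [InnerProductSpace ℂ E]
  [NormedAddCommGroup F] [InnerProductSpace ℂ F]

theorem map_eq_smul {u : E →ₗᵢ[ℂ] E} {v : F →ₗᵢ[ℂ] F} {a b : ℂ} (hu : ∀ x, u x = a • x)
    (hv : ∀ x, v x = b • x) (x : HilbertTensor E F) : map u v x = (a * b) • x := by
  refine denseRange_incl.induction_on (p := fun x => map u v x = (a * b) • x) x
    (isClosed_eq (map u v).continuous (continuous_const_smul _)) fun y => ?_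
  rw [map_incl, ← map_smul]
  congr 1
  induction y with
  | zero => simp
  | tmul x y =>
    change u x ⊗ₜ v y = _
    rw [hu, hv, TensorProduct.smul_tmul_smul]
  | add x y hx hy => rw [map_add, hx, hy, smul_add]

theorem tmul_ne_zero {a : E} {b : F} (ha : a ≠ 0) (hb : b ≠ 0) : tmul a b ≠ 0 := by
  intro h
  have := inner_tmul a a b b
  rw [h, inner_zero_left] at this
  exact mul_ne_zero (inner_self_ne_zero.2 ha) (inner_self_ne_zero.2 hb) this.symm

end HilbertTensor

variable {H : Type u} [NormedAddCommGroup H] [InnerProductSpace ℂ H]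

theorem tensorUnitary_eq_smul_id {u v w : H ≃ₗᵢ[ℂ] H} {a b c : ℂ} (hu : ∀ x, u x = a • x)
    (hv : ∀ x, v x = b • x) (hw : ∀ x, w x = c • x) :
    tensorUnitary u v w = (a * b * c) • ContinuousLinearMap.id ℂ (HilbertTensor3 H) := by
  ext x
  refine (HilbertTensor.map_eq_smul (a := a) (b := b * c) hu
    (HilbertTensor.map_eq_smul hv hw) x).trans ?_
  rw [← mul_assoc]; rfl

theorem enorm_sum_smul_tensorUnitary_eq [Nontrivial H] {n : ℕ} (t : Tensor3 n)
    {u v w : Fin n → (H ≃ₗᵢ[ℂ] H)} {a b c : Fin n → Circle}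
    (hu : ∀ i x, u i x = (a i : ℂ) • x) (hv : ∀ i x, v i x = (b i : ℂ) • x)
    (hw : ∀ i x, w i x = (c i : ℂ) • x) :
    ‖∑ i, ∑ j, ∑ k, t i j k • tensorUnitary (u i) (v j) (w k)‖ₑ =
      ‖∑ i, ∑ j, ∑ k, t i j k * (a i : ℂ) * (b j : ℂ) * (c k : ℂ)‖ₑ := by
  obtain ⟨x, hx⟩ := exists_ne (0 : H)
  have : Nontrivial (HilbertTensor3 H) := ⟨HilbertTensor.tmul x (HilbertTensor.tmul x x), 0,
    HilbertTensor.tmul_ne_zero hx (HilbertTensor.tmul_ne_zero hx hx)⟩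
  have e : ∑ i, ∑ j, ∑ k, t i j k • tensorUnitary (u i) (v j) (w k) =
      (∑ i, ∑ j, ∑ k, t i j k * (a i : ℂ) * (b j : ℂ) * (c k : ℂ)) •
        ContinuousLinearMap.id ℂ (HilbertTensor3 H) := by
    simp only [Finset.sum_smul]
    refine Finset.sum_congr rfl fun i _ => Finset.sum_congr rfl fun j _ =>
      Finset.sum_congr rfl fun k _ => ?_
    rw [tensorUnitary_eq_smul_id (hu i) (hv j) (hw k), smul_smul]
    congr 1; ring
  rw [e]
  rw [← ofReal_norm, ← ofReal_norm, norm_smul, ContinuousLinearMap.norm_id, mul_one]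

/-- Multiplication by a unimodular scalar. -/
noncomputable def circleSMul (H : Type u) [NormedAddCommGroup H] [InnerProductSpace ℂ H]
    (c : Circle) : H ≃ₗᵢ[ℂ] H where
  toLinearEquiv := LinearEquiv.smulOfNeZero ℂ H (c : ℂ) c.coe_ne_zero
  norm_map' x := by
    refine (norm_smul (c : ℂ) x).trans ?_
    rw [Circle.norm_coe, one_mul]

theorem exists_circle_of_finrank_eq_one (hH : Module.finrank ℂ H = 1) (u : H ≃ₗᵢ[ℂ] H) :
    ∃ c : Circle, ∀ x, u x = (c : ℂ) • x := by
  obtain ⟨v, hv, h⟩ := finrank_eq_one_iff'.1 hH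
  obtain ⟨c, hc⟩ := h (u v)
  have hn : ‖c‖ = 1 := by
    have := u.norm_map v
    rw [← hc, norm_smul] at this
    exact mul_right_cancel₀ (norm_ne_zero_iff.2 hv) (by rw [this, one_mul])
  refine ⟨⟨c, mem_sphere_zero_iff_norm.2 hn⟩, fun x => ?_⟩
  obtain ⟨d, rfl⟩ := h x
  rw [map_smul, ← hc, smul_comm]

theorem veeNorm_eq_unitarySup {n : ℕ} (t : Tensor3 n) (hH : Module.finrank ℂ H = 1) :
    veeNorm t = unitarySup H t := by
  have : Nontrivial H := Module.nontrivial_of_finrank_pos (R := ℂ) (by omega)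
  refine le_antisymm ?_ ?_
  · refine iSup_le fun a => iSup_le fun b => iSup_le fun c => ?_
    refine le_iSup_of_le (fun i => circleSMul H (a i)) (le_iSup_of_le (fun i => circleSMul H (b i))
      (le_iSup_of_le (fun i => circleSMul H (c i)) ?_))
    exact (enorm_sum_smul_tensorUnitary_eq t (fun _ _ => rfl) (fun _ _ => rfl)
      (fun _ _ => rfl)).ge
  · refine iSup_le fun u => iSup_le fun v => iSup_le fun w => ?_
    choose a ha using fun i => exists_circle_of_finrank_eq_one hH (u i)
    choose b hb using fun i => exists_circle_of_finrank_eq_one hH (v i)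
    choose c hc using fun i => exists_circle_of_finrank_eq_one hH (w i)
    exact le_iSup_of_le a (le_iSup_of_le b (le_iSup_of_le c
      (enorm_sum_smul_tensorUnitary_eq t ha hb hc).le))

end OneDimensional

/-! ### Normalization, arbitrary `n`, and the final constants. -/

section LowerBound

theorem ofReal_div_le_C3 {n : ℕ} (t : Tensor3 n) {A K : ℝ} (hK : 0 < K)
    (hv : ∀ x y z : Fin n → Circle,
      ‖∑ i, ∑ j, ∑ k, t i j k * (x i : ℂ) * (y j : ℂ) * (z k : ℂ)‖ ≤ K)
    (H : Type u) [NormedAddCommGroup H] [InnerProductSpace ℂ H] [CompleteSpace H]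
    (u v w : Fin n → (H ≃ₗᵢ[ℂ] H))
    (hA : A ≤ ‖∑ i, ∑ j, ∑ k, t i j k • tensorUnitary (u i) (v j) (w k)‖) :
    ENNReal.ofReal (A / K) ≤ C3.{u} n := by
  let s : Tensor3 n := fun i j k => (K⁻¹ : ℂ) * t i j k
  have hs : veeNorm s ≤ 1 := by
    refine iSup_le fun x => iSup_le fun y => iSup_le fun z => ?_
    have e : ∑ i, ∑ j, ∑ k, s i j k * (x i : ℂ) * (y j : ℂ) * (z k : ℂ) =
        (K⁻¹ : ℂ) * ∑ i, ∑ j, ∑ k, t i j k * (x i : ℂ) * (y j : ℂ) * (z k : ℂ) := by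
      simp only [s, Finset.mul_sum, mul_assoc]
    rw [e, ← ofReal_norm, ENNReal.ofReal_le_one, norm_mul, norm_inv, Complex.norm_real,
      Real.norm_of_nonneg hK.le, inv_mul_le_one₀ hK]
    exact hv x y z
  refine le_iSup_of_le s (le_iSup_of_le hs ?_)
  refine le_iSup_of_le H (le_iSup_of_le ‹_› (le_iSup_of_le ‹_› (le_iSup_of_le ‹_› ?_)))
  refine le_iSup_of_le u (le_iSup_of_le v (le_iSup_of_le w ?_))
  have e : ∑ i, ∑ j, ∑ k, s i j k • tensorUnitary (u i) (v j) (w k) =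
      (K⁻¹ : ℂ) • ∑ i, ∑ j, ∑ k, t i j k • tensorUnitary (u i) (v j) (w k) := by
    simp only [s, Finset.smul_sum, mul_smul]
  rw [e, ← ofReal_norm]
  refine ENNReal.ofReal_le_ofReal ?_
  rw [norm_smul, norm_inv, Complex.norm_real, Real.norm_of_nonneg hK.le, div_eq_inv_mul]
  gcongr

/-- Pushing the tensor forward along `e` preserves its pairings, so `n` need not be a perfect
square. It is used with scalar values for the scalar supremum and with operator values for the
operator norm. -/
theorem sum_smul_ite_embedding {κ : Type*} [Fintype κ] {n : ℕ} (e : κ → Fin n) {M : Type*}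
    [AddCommMonoid M] [Module ℂ M] (t : κ → κ → κ → ℂ) (φ : Fin n → Fin n → Fin n → M) :
    ∑ i, ∑ j, ∑ k, (∑ a, ∑ b, ∑ c, if e a = i ∧ e b = j ∧ e c = k then t a b c else 0) • φ i j k =
      ∑ a, ∑ b, ∑ c, t a b c • φ (e a) (e b) (e c) := by
  have h : ∑ p : Fin n × Fin n × Fin n, (∑ q : κ × κ × κ,
      if e q.1 = p.1 ∧ e q.2.1 = p.2.1 ∧ e q.2.2 = p.2.2 then t q.1 q.2.1 q.2.2 else 0) •
        φ p.1 p.2.1 p.2.2 =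
      ∑ q : κ × κ × κ, t q.1 q.2.1 q.2.2 • φ (e q.1) (e q.2.1) (e q.2.2) := by
    simp only [Finset.sum_smul]
    rw [Finset.sum_comm]
    refine Finset.sum_congr rfl fun q _ => ?_
    rw [Finset.sum_eq_single (e q.1, e q.2.1, e q.2.2)]
    · simp
    · rintro ⟨i, j, k⟩ - hne
      rw [if_neg, zero_smul]
      rintro ⟨rfl, rfl, rfl⟩
      exact hne rfl
    · simp
  simpa only [Fintype.sum_prod_type] using h

/-- The lower bound obtained from the group `G` when `|G|² ≤ n`. -/
theorem ofReal_card_div_le_C3 (G : Type u) [AddCommGroup G] [Fintype G] {n L : ℕ}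
    (hn : Fintype.card G ^ 2 ≤ n) (hL : Fintype.card G ≤ 4 ^ L) :
    ENNReal.ofReal (Real.sqrt (Fintype.card G) / (327680 * Real.sqrt (5 * (L + 1)) ^ 3)) ≤
      C3.{u} n := by
  classical
  obtain ⟨g, h, hg, hh, H⟩ := exists_boundedOnTriangularRanks G
  set N := Fintype.card G with hN
  have hN0 : 0 < N := Fintype.card_pos
  obtain ⟨e⟩ : Nonempty (AddChar G ℂ × G ↪ Fin n) :=
    Function.Embedding.nonempty_of_card_le (by
      rw [Fintype.card_prod, AddChar.card_eq, Fintype.card_fin, ← sq]; exact hn)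
  let t : AddChar G ℂ × G → AddChar G ℂ × G → AddChar G ℂ × G → ℂ := fun a b c =>
    trilinForm (fun p => (g p : ℂ)) (fun p => (h p : ℂ)) (pauli a) (pauli b) (pauli c)
  let T : Tensor3 n := fun i j k =>
    ∑ a, ∑ b, ∑ c, if e a = i ∧ e b = j ∧ e c = k then t a b c else 0
  set S := Real.sqrt (5 * ((L : ℝ) + 1))
  have hS : 0 < S := Real.sqrt_pos.2 (by positivity)
  set ν := Real.sqrt (N : ℝ) with hν
  have hN0' : (0 : ℝ) < N := by exact_mod_cast hN0
  have hν0 : 0 < ν := Real.sqrt_pos.2 hN0'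
  have hνsq : (N : ℝ) = ν ^ 2 := (Real.sq_sqrt hN0'.le).symm
  -- Factor `8` for complexification, `40960 N S³` from the random signs, and one Frobenius norm `N
  -- ν = N^{3/2}` per argument. Then `N⁶ / K = ν / (327680 S³)`.
  set K : ℝ := 8 * (40960 * N * S ^ 3) * ((N * ν) * (N * ν) * (N * ν))
  have hK : 0 < K := by positivity
  have key := ofReal_div_le_C3 T (A := (N : ℝ) ^ 6) hK ?_ (EuclideanSpace ℂ G)
    -- Indices outside the range of `e` receive the identity; the coefficients of `T` vanish there.
    (Function.extend e pauliConj 1) (Function.extend e pauliConj 1)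
    (Function.extend e pauliConj 1) ?_
  · have : (N : ℝ) ^ 6 / K = ν / (327680 * S ^ 3) := by
      simp only [K, hνsq]
      field_simp
      norm_num
    rwa [this] at key
  · intro x y z
    have e1 := sum_smul_ite_embedding e t (fun i j k => (x i : ℂ) * (y j : ℂ) * (z k : ℂ))
    have e2 : trilinForm (fun p => (g p : ℂ)) (fun p => (h p : ℂ))
        (∑ a, (x (e a) : ℂ) • pauli a) (∑ a, (y (e a) : ℂ) • pauli a)
        (∑ a, (z (e a) : ℂ) • pauli a) = ∑ a, ∑ b, ∑ c, t a b c •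
          ((x (e a) : ℂ) * (y (e b) : ℂ) * (z (e c) : ℂ)) := by
      rw [trilinForm_sum_sum_sum]
      simp only [trilinForm_smul_smul_smul, t, smul_eq_mul, mul_comm]
    have e3 : ∑ i, ∑ j, ∑ k, T i j k * (x i : ℂ) * (y j : ℂ) * (z k : ℂ) =
        trilinForm (fun p => (g p : ℂ)) (fun p => (h p : ℂ))
        (∑ a, (x (e a) : ℂ) • pauli a) (∑ a, (y (e a) : ℂ) • pauli a)
        (∑ a, (z (e a) : ℂ) • pauli a) := by
      rw [e2, ← e1]
      simp only [T, smul_eq_mul, mul_assoc]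
    rw [e3]
    refine (norm_trilinForm_ofReal_le (by positivity)
      (H.abs_trilinForm_le_frobNorm (by positivity) hL) _ _ _).trans (le_of_eq ?_)
    rw [frobNorm_sum_smul_pauli _ fun a => Circle.norm_coe _,
      frobNorm_sum_smul_pauli _ fun a => Circle.norm_coe _,
      frobNorm_sum_smul_pauli _ fun a => Circle.norm_coe _]
  · have e1 := sum_smul_ite_embedding e t (fun i j k => tensorUnitary
      (Function.extend e pauliConj 1 i) (Function.extend e pauliConj 1 j)
      (Function.extend e pauliConj 1 k))
    simp only [e.injective.extend_apply] at e1
    rw [e1]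
    exact card_pow_six_le_norm_sum_smul_tensorUnitary g h hg hh

theorem rpow_quarter_mul_log_rpow_le {n : ℕ} (hn : 2 ≤ n) :
    (1 / 2 ^ 26 : ℝ) * (n : ℝ) ^ (1 / 4 : ℝ) * (Real.log n) ^ (-(3 / 2) : ℝ) ≤
      Real.sqrt (Nat.sqrt n) / (327680 * Real.sqrt (5 * ((Nat.log 2 n : ℕ) + 1)) ^ 3) := by
  set N := Nat.sqrt n
  set L := Nat.log 2 n with hL
  set l := Real.log n with hl
  have hn' : (2 : ℝ) ≤ n := by exact_mod_cast hn
  have l0 : 0 < l := Real.log_pos (by linarith)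
  have hN1 : 1 ≤ N := Nat.le_sqrt.2 (by omega)
  have hnN : (n : ℝ) ≤ (2 * Real.sqrt N) ^ 4 := by
    have h1 : n < (N + 1) * (N + 1) := Nat.lt_succ_sqrt n
    have h2 : n ≤ 16 * N ^ 2 := by nlinarith
    have h3 : (n : ℝ) ≤ 16 * (N : ℝ) ^ 2 := by exact_mod_cast h2
    have h4 : Real.sqrt (N : ℝ) ^ 2 = N := Real.sq_sqrt (by positivity)
    calc (n : ℝ) ≤ 16 * (N : ℝ) ^ 2 := h3
      _ = 16 * (Real.sqrt N ^ 2) ^ 2 := by rw [h4]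
      _ = _ := by ring
  have h1 : (n : ℝ) ^ (1 / 4 : ℝ) ≤ 2 * Real.sqrt N := by
    calc (n : ℝ) ^ (1 / 4 : ℝ) ≤ ((2 * Real.sqrt N) ^ 4) ^ (1 / 4 : ℝ) :=
          Real.rpow_le_rpow (by positivity) hnN (by norm_num)
      _ = 2 * Real.sqrt N := by
          rw [← Real.rpow_natCast, ← Real.rpow_mul (by positivity)]; norm_num
  have hL1 : 1 ≤ L := Nat.le_log_of_pow_le (by norm_num) (by simpa using hn)
  -- `L + 1 ≤ 2L ≤ 2l / log 2`, and `2 / log 2 < 3`. Hence `5(L + 1) ≤ 15l ≤ 16l`, which gives the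
  -- `4` in `hsq`.
  have hLl : (L : ℝ) + 1 ≤ 3 * l := by
    have h2 : (2 : ℝ) ^ L ≤ n := by exact_mod_cast Nat.pow_log_le_self 2 (by omega)
    have h3 : L * Real.log 2 ≤ l := by
      rw [← Real.log_pow]; exact Real.log_le_log (by positivity) h2
    have h4 := Real.log_two_gt_d9
    have h5 : (1 : ℝ) ≤ L := by exact_mod_cast hL1
    nlinarith
  have hsq : Real.sqrt (5 * ((L : ℝ) + 1)) ≤ 4 * Real.sqrt l := by
    refine Real.sqrt_le_iff.2 ⟨by positivity, ?_⟩
    rw [mul_pow, Real.sq_sqrt l0.le]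
    linarith
  have hlr : l ^ (-(3 / 2) : ℝ) = (Real.sqrt l ^ 3)⁻¹ := by
    rw [Real.rpow_neg l0.le, Real.sqrt_eq_rpow, ← Real.rpow_natCast, ← Real.rpow_mul l0.le]
    norm_num
  have sl0 : 0 < Real.sqrt l := Real.sqrt_pos.2 l0
  have hS0 : 0 < Real.sqrt (5 * ((L : ℝ) + 1)) := Real.sqrt_pos.2 (by positivity)
  rw [hlr]
  calc (1 / 2 ^ 26 : ℝ) * (n : ℝ) ^ (1 / 4 : ℝ) * (Real.sqrt l ^ 3)⁻¹
      ≤ (1 / 2 ^ 26 : ℝ) * (2 * Real.sqrt N) * (Real.sqrt l ^ 3)⁻¹ := by gcongr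
    -- `327680 · 4³ = 20971520` is below `2²⁵ = 2²⁶ / 2`, which is why `1 / 2²⁶` is small enough.
    _ ≤ Real.sqrt N / (327680 * (4 * Real.sqrt l) ^ 3) := by
        have e : Real.sqrt N / (327680 * (4 * Real.sqrt l) ^ 3) =
            1 / 20971520 * (Real.sqrt N * (Real.sqrt l ^ 3)⁻¹) := by
          field_simp
          norm_num
        rw [e]
        have : 0 ≤ Real.sqrt N * (Real.sqrt l ^ 3)⁻¹ := by positivity
        nlinarith
    _ ≤ _ := by gcongr

end LowerBound

theorem theorem2 :
    (∀ (n : ℕ) (t : Tensor3 n) (H : Type u) [NormedAddCommGroup H] [InnerProductSpace ℂ H]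
      [CompleteSpace H], Module.finrank ℂ H = 1 → veeNorm t = unitarySup H t) ∧
    ∃ C' : ℝ, 0 < C' ∧ ∀ n : ℕ, 2 ≤ n →
      ENNReal.ofReal (C' * (n : ℝ) ^ (1 / 4 : ℝ) * (Real.log n) ^ (-(3 / 2) : ℝ)) ≤ C3.{u} n := by
  refine ⟨fun n t H _ _ _ hH => veeNorm_eq_unitarySup t hH, 1 / 2 ^ 26, by positivity,
    fun n hn => ?_⟩
  have : NeZero (Nat.sqrt n) := ⟨(Nat.sqrt_pos.2 (by omega)).ne'⟩
  -- The cyclic group is lifted so that the Hilbert space `ℂ^G` lives in the universe over which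
  -- `C3` takes its supremum.
  have hc : Fintype.card (ULift.{u} (ZMod (Nat.sqrt n))) = Nat.sqrt n := by
    rw [Fintype.card_ulift, ZMod.card]
  have hN2 : Nat.sqrt n ^ 2 ≤ n := Nat.sqrt_le' n
  have hL : Nat.sqrt n ≤ 4 ^ Nat.log 2 n := by
    have h1 : n < 2 ^ (Nat.log 2 n + 1) := Nat.lt_pow_succ_log_self (by norm_num) n
    have h2 : 1 ≤ Nat.log 2 n := Nat.le_log_of_pow_le (by norm_num) (by simpa using hn)
    calc Nat.sqrt n ≤ n := Nat.sqrt_le_self n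
      _ ≤ 2 ^ (Nat.log 2 n + 1) := h1.le
      _ ≤ 2 ^ (2 * Nat.log 2 n) := Nat.pow_le_pow_right (by norm_num) (by omega)
      _ = 4 ^ Nat.log 2 n := by rw [pow_mul]; norm_num
  have key := ofReal_card_div_le_C3 (ULift.{u} (ZMod (Nat.sqrt n))) (n := n) (L := Nat.log 2 n)
    (by rw [hc]; exact hN2) (by rw [hc]; exact hL)
  rw [hc] at key
  exact (ENNReal.ofReal_le_ofReal (rpow_quarter_mul_log_rpow_le hn)).trans key
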